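/- Let $(A,\mathfrak m)$ be a Noetherian local ring with infinite residue field, let $I$ be an $\mathfrak m$-primary ideal, and let $M$ be a finitely generated Cohen--Macaulay $A$-module of dimension one. Let $G_I(M)=\bigoplus_{n\ge 0} I^nM/I^{n+1}M$ be the associated graded module, regarded as a graded module over $G=\bigoplus_{n\ge 0} I^n/I^{n+1}$ with irrelevant ideal $G_+=\bigoplus_{n>0}I^n/I^{n+1}$. Its Castelnuovo--Mumford regularity is $$\operatorname{reg}(G_I(M))=\max\{a_i+i \mid 0\le i\le \dim G_I(M)\},\qquad a_i=\sup\{n\in\mathbb Z \mid H^i_{G_+}(G_I(M))_n\ne 0\},$$ with $\sup\emptyset=-\infty$. Let $e_0=e_0(I,M)$ be the zeroth Hilbert coefficient of $M$ with respect to $I$, i.e. $\ell(M/I^{n+1}M)=e_0\cdot(n+1)-e_1$ for all $n\gg 0$, with integers $e_0,e_1$. Let $b$ be the largest integer such that $IM\subseteq \mathfrak m^bM$. Then $$\operatorname{reg}(G_I(M))\le e_0-b .$$ In particular, if $b>1$, then $\operatorname{reg}(G_I(M))< e_0-1$. -/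

import Mathlib

open scoped DirectSum

noncomputable section

/-! ## The associated graded ring and module -/

section AssociatedGraded

variable {A : Type*} [CommRing A] (I : Ideal A) (M : Type*) [AddCommGroup M] [Module A M]

/-- The homogeneous piece `I ^ n M / I ^ (n + 1) M` of degree `n`. -/
def GrPiece (n : ℕ) : Type _ :=
  (I ^ n • ⊤ : Submodule A M) ⧸
    (I ^ (n + 1) • ⊤ : Submodule A M).submoduleOf (I ^ n • ⊤ : Submodule A M)

instance (n : ℕ) : AddCommGroup (GrPiece I M n) :=
  inferInstanceAs (AddCommGroup ((I ^ n • ⊤ : Submodule A M) ⧸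
    (I ^ (n + 1) • ⊤ : Submodule A M).submoduleOf (I ^ n • ⊤ : Submodule A M)))

instance (n : ℕ) : Module A (GrPiece I M n) :=
  inferInstanceAs (Module A ((I ^ n • ⊤ : Submodule A M) ⧸
    (I ^ (n + 1) • ⊤ : Submodule A M).submoduleOf (I ^ n • ⊤ : Submodule A M)))

variable {M}

/-- The class of an element `x ∈ I ^ n M` in `I ^ n M / I ^ (n + 1) M`. -/
def grMk (n : ℕ) (x : M) (hx : x ∈ (I ^ n • ⊤ : Submodule A M)) : GrPiece I M n :=
  Submodule.Quotient.mk ⟨x, hx⟩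

lemma grMk_surj {n : ℕ} (a : GrPiece I M n) : ∃ x hx, a = grMk I n x hx := by
  obtain ⟨⟨x, hx⟩, rfl⟩ := Submodule.Quotient.mk_surjective _ a
  exact ⟨x, hx, rfl⟩

lemma grMk_sigma {m n : ℕ} (h : m = n) {x y : M} (hxy : x = y)
    (hx : x ∈ (I ^ m • ⊤ : Submodule A M)) (hy : y ∈ (I ^ n • ⊤ : Submodule A M)) :
    (⟨m, grMk I m x hx⟩ : GradedMonoid (GrPiece I M)) = ⟨n, grMk I n y hy⟩ := by
  subst h hxy; rfl

lemma smul_mem_grPow {m n : ℕ} {a : A} {x : M} (ha : a ∈ (I ^ m • ⊤ : Submodule A A))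
    (hx : x ∈ (I ^ n • ⊤ : Submodule A M)) : a • x ∈ (I ^ (m + n) • ⊤ : Submodule A M) := by
  rw [pow_add, Submodule.mul_smul]
  refine Submodule.smul_mem_smul ?_ hx
  simpa using ha

variable (M)

/-- The product `(I ^ m / I ^ (m + 1)) × (I ^ n M / I ^ (n + 1) M) → I ^ (m + n) M / I ^ (m + n + 1) M`
induced by the scalar multiplication of `M`. -/
def grSMul (m n : ℕ) : GrPiece I A m →ₗ[A] GrPiece I M n →ₗ[A] GrPiece I M (m + n) :=
  LinearMap.liftQ₂ _ _
    (LinearMap.mk₂ A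
      (fun (a : (I ^ m • ⊤ : Submodule A A)) (x : (I ^ n • ⊤ : Submodule A M)) =>
        grMk I (m + n) ((a : A) • (x : M)) (smul_mem_grPow I a.2 x.2))
      (fun a b x => congrArg Submodule.Quotient.mk (Subtype.ext (add_smul (a : A) b (x : M))))
      (fun c a x => congrArg Submodule.Quotient.mk (Subtype.ext (smul_assoc c (a : A) (x : M))))
      (fun a x y => congrArg Submodule.Quotient.mk (Subtype.ext (smul_add (a : A) (x : M) y)))
      (fun c a x => congrArg Submodule.Quotient.mk (Subtype.ext (smul_comm (a : A) c (x : M)))))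
    (by
      intro a ha
      rw [LinearMap.mem_ker]
      ext x
      refine (Submodule.Quotient.mk_eq_zero _).2 ?_
      have := smul_mem_grPow I (m := m + 1) (a := (a : A)) ha x.2
      rw [Nat.add_right_comm] at this
      exact this)
    (by
      intro x hx
      rw [LinearMap.mem_ker]
      ext a
      refine (Submodule.Quotient.mk_eq_zero _).2 ?_
      exact smul_mem_grPow I (n := n + 1) a.2 hx)

variable {M}

lemma grSMul_mk {m n : ℕ} {a : A} {x : M} (ha : a ∈ (I ^ m • ⊤ : Submodule A A))
    (hx : x ∈ (I ^ n • ⊤ : Submodule A M)) :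
    grSMul I M m n (grMk I m a ha) (grMk I n x hx) =
      grMk I (m + n) (a • x) (smul_mem_grPow I ha hx) := rfl

lemma one_mem_grPow : (1 : A) ∈ (I ^ 0 • ⊤ : Submodule A A) := by simp

instance : GradedMonoid.GOne (GrPiece I A) where
  one := grMk I 0 1 (one_mem_grPow I)

instance : GradedMonoid.GMul (GrPiece I A) where
  mul {m n} a b := grSMul I A m n a b

/-- The graded ring structure on the pieces of `⨁ n, I ^ n / I ^ (n + 1)`. -/
instance : DirectSum.GCommRing (GrPiece I A) where
  mul_zero a := map_zero _
  zero_mul b := LinearMap.map_zero₂ _ b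
  mul_add a b c := map_add _ _ _
  add_mul a b c := LinearMap.map_add₂ _ a b c
  one_mul := by
    rintro ⟨n, a⟩
    obtain ⟨x, hx, rfl⟩ := grMk_surj I a
    exact grMk_sigma I (zero_add n) (one_mul x) _ _
  mul_one := by
    rintro ⟨n, a⟩
    obtain ⟨x, hx, rfl⟩ := grMk_surj I a
    exact grMk_sigma I (add_zero n) (mul_one x) _ _
  mul_assoc := by
    rintro ⟨m, a⟩ ⟨n, b⟩ ⟨k, c⟩
    obtain ⟨x, hx, rfl⟩ := grMk_surj I a
    obtain ⟨y, hy, rfl⟩ := grMk_surj I b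
    obtain ⟨z, hz, rfl⟩ := grMk_surj I c
    exact grMk_sigma I (add_assoc m n k) (mul_assoc x y z) _ _
  mul_comm := by
    rintro ⟨m, a⟩ ⟨n, b⟩
    obtain ⟨x, hx, rfl⟩ := grMk_surj I a
    obtain ⟨y, hy, rfl⟩ := grMk_surj I b
    exact grMk_sigma I (add_comm m n) (mul_comm x y) _ _
  natCast k := k • grMk I 0 1 (one_mem_grPow I)
  natCast_zero := zero_smul _ _
  natCast_succ k := succ_nsmul _ _
  intCast k := k • grMk I 0 1 (one_mem_grPow I)
  intCast_ofNat k := natCast_zsmul _ _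
  intCast_negSucc_ofNat k := negSucc_zsmul _ _

/-- The graded module structure on the pieces of `⨁ n, I ^ n M / I ^ (n + 1) M`. -/
instance : DirectSum.Gmodule (GrPiece I A) (GrPiece I M) where
  smul {m n} a x := grSMul I M m n a x
  one_smul := by
    rintro ⟨n, a⟩
    obtain ⟨x, hx, rfl⟩ := grMk_surj I a
    exact grMk_sigma I (zero_add n) (one_smul A x) _ _
  mul_smul := by
    rintro ⟨m, a⟩ ⟨n, b⟩ ⟨k, c⟩
    obtain ⟨x, hx, rfl⟩ := grMk_surj I a
    obtain ⟨y, hy, rfl⟩ := grMk_surj I b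
    obtain ⟨z, hz, rfl⟩ := grMk_surj I c
    exact grMk_sigma I (add_assoc m n k) (mul_smul x y z) _ _
  smul_add a x y := map_add _ _ _
  smul_zero a := map_zero _
  add_smul a b x := LinearMap.map_add₂ _ a b x
  zero_smul x := LinearMap.map_zero₂ _ x

variable (M)

/-- The associated graded ring `G = ⨁ n, I ^ n / I ^ (n + 1)`. -/
abbrev GrRing : Type _ := ⨁ n, GrPiece I A n

/-- The associated graded module `G_I(M) = ⨁ n, I ^ n M / I ^ (n + 1) M`,
a module over `GrRing I`. -/
abbrev GrModule : Type _ := ⨁ n, GrPiece I M n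

/-- The homogeneous component of degree `n ∈ ℤ` of the associated graded module (zero for `n < 0`):
the elements all of whose coordinates in degrees different from `n` vanish. -/
def grComponent (n : ℤ) : AddSubgroup (GrModule I M) where
  carrier := {e | ∀ k : ℕ, (k : ℤ) ≠ n → e k = 0}
  add_mem' {a b} ha hb k hk := by
    simp [DirectSum.add_apply, ha k hk, hb k hk]
  zero_mem' k _ := rfl
  neg_mem' {a} ha k hk := by
    have : (-a) k = -(a k) := rfl
    rw [this, ha k hk, neg_zero]

/-- The irrelevant ideal `G_+ = ⨁ n > 0, I ^ n / I ^ (n + 1)` of the associated graded ring. -/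
def grIrrelevant : Ideal (GrRing I) :=
  Ideal.span {a | ∃ n : ℕ, 0 < n ∧ ∃ y : GrPiece I A n, a = DirectSum.of (GrPiece I A) n y}

end AssociatedGraded

/-! ## Graded local cohomology through the Čech complex -/

section Cech

variable {R : Type*} [CommRing R] {s : ℕ} (f : Fin s → R) (E : Type*) [AddCommGroup E] [Module R E]

/-- The localization of `E` at the product of the `f j`, `j ∈ J`. -/
abbrev CechLoc (J : Finset (Fin s)) : Type _ :=
  LocalizedModule (Submonoid.powers (∏ j ∈ J, f j)) E

lemma cechLoc_isUnit {K J : Finset (Fin s)} (h : K ⊆ J)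
    (x : Submonoid.powers (∏ j ∈ K, f j)) :
    IsUnit (algebraMap R (Module.End R (CechLoc f E J)) x) := by
  obtain ⟨x, hx⟩ := x
  obtain ⟨k, rfl⟩ := Submonoid.mem_powers_iff _ _ |>.1 hx
  have hu := IsLocalizedModule.map_units
    (LocalizedModule.mkLinearMap (Submonoid.powers (∏ j ∈ J, f j)) E) ⟨(∏ j ∈ J, f j) ^ k, pow_mem (Submonoid.mem_powers _) k⟩
  obtain ⟨c, hc⟩ := pow_dvd_pow_of_dvd (Finset.prod_dvd_prod_of_subset K J f h) k
  simp only at hu ⊢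
  rw [hc, map_mul, Commute.isUnit_mul_iff (Algebra.commutes _ _)] at hu
  exact hu.1

/-- The canonical map between localizations for `K ⊆ J`. -/
def cechRes {K J : Finset (Fin s)} (h : K ⊆ J) : CechLoc f E K →ₗ[R] CechLoc f E J :=
  LocalizedModule.lift _ (LocalizedModule.mkLinearMap _ E) (cechLoc_isUnit f E h)

/-- The Čech cochains of degree `p`: the product of the localizations of `E` at
`f j₁ ⋯ f jₚ`, over all `j₁ < ⋯ < jₚ`. In degree `0` this is (a copy of) `E`. -/
abbrev CechCochain (p : ℕ) : Type _ :=
  (J : {J : Finset (Fin s) // J.card = p}) → CechLoc f E J.1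

/-- The Čech differential: the component at `J` is the alternating sum, over `j ∈ J`, of the
restrictions of the components at `J \ {j}`; the sign is given by the position of `j` in `J`. -/
def cechD (p : ℕ) : CechCochain f E p →ₗ[R] CechCochain f E (p + 1) :=
  LinearMap.pi fun J =>
    ∑ j : {j // j ∈ J.1}, (-1 : R) ^ (J.1.filter (· < j.1)).card •
      (cechRes f E (Finset.erase_subset j.1 J.1)).comp
        (LinearMap.proj (⟨J.1.erase j.1, by
          rw [Finset.card_erase_of_mem j.2, J.2, Nat.add_sub_cancel]⟩ :
            {J : Finset (Fin s) // J.card = p}))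

/-- The Čech coboundaries of degree `p`. -/
def cechB : (p : ℕ) → Submodule R (CechCochain f E p)
  | 0 => ⊥
  | p + 1 => LinearMap.range (cechD f E p)

/-- The cohomology in degree `p` of the Čech complex of `E` with respect to `f`. Over a Noetherian
ring this is the local cohomology module `H^p` of `E` with support in the ideal generated by `f`. -/
abbrev CechH (p : ℕ) : Type _ :=
  LinearMap.ker (cechD f E p) ⧸ (cechB f E p).submoduleOf (LinearMap.ker (cechD f E p))

variable {E} (ℰ : ℤ → AddSubgroup E)

/-- For a grading `ℰ` of `E` and `f j` homogeneous of degree `1`, the homogeneous component of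
degree `n` of a localization: the fractions `e / (∏ j ∈ J, f j) ^ k` with `e` homogeneous of degree
`n + k * #J`. (These fractions are closed under addition, so the closure adds nothing.) -/
def cechLocDeg (J : Finset (Fin s)) (n : ℤ) : AddSubgroup (CechLoc f E J) :=
  AddSubgroup.closure {y | ∃ (k : ℕ) (e : E), e ∈ ℰ (n + k * J.card) ∧
    y = LocalizedModule.mk e ⟨(∏ j ∈ J, f j) ^ k, pow_mem (Submonoid.mem_powers _) k⟩}

/-- The homogeneous component of degree `n` of the Čech cohomology: the classes of the cocycles
that are homogeneous of degree `n`. -/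
def cechHDeg (p : ℕ) (n : ℤ) : AddSubgroup (CechH f E p) :=
  AddSubgroup.closure {y | ∃ c : LinearMap.ker (cechD f E p),
    (∀ J, c.1 J ∈ cechLocDeg f ℰ J.1 n) ∧ y = Submodule.Quotient.mk c}

/-- `a_p(E) = sup {n | H^p(E)_n ≠ 0}`, which is `-∞` if there is no such `n`. -/
def aInvariant (p : ℕ) : EReal :=
  ⨆ (n : ℤ) (_ : cechHDeg f ℰ p n ≠ ⊥), ((n : ℝ) : EReal)

/-- The Castelnuovo–Mumford regularity `max {a_p(E) + p | 0 ≤ p ≤ dim E}` of the graded module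
`E = ⨁ n, ℰ n`, where local cohomology is computed with the homogeneous generators `f`, of
degree `1`, of the irrelevant ideal. -/
def cmRegularity : EReal :=
  ⨆ (p : ℕ) (_ : (p : WithBot ℕ∞) ≤ Module.supportDim R E), aInvariant f ℰ p + ((p : ℝ) : EReal)

end Cech

/-! ## Hilbert coefficients and Cohen–Macaulay modules -/

section Local

variable {A : Type*} [CommRing A] (I : Ideal A) (M : Type*) [AddCommGroup M] [Module A M]

/-- The dimension of a nonzero module of finite dimension, as a natural number. -/
def moduleDim (A : Type*) [CommRing A] (M : Type*) [AddCommGroup M] [Module A M] : ℕ :=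
  ((Module.supportDim A M).unbotD 0).toNat

/-- The family `e` consists of the Hilbert coefficients of `M` with respect to `I`: with `r = dim M`,
the length of `M / I ^ (n + 1) M` equals `∑ i ≤ r, (-1) ^ i * e i * (n + r - i).choose (r - i)`
for all large `n`. -/
def IsHilbertCoeffs (e : Fin (moduleDim A M + 1) → ℤ) : Prop :=
  ∀ᶠ n : ℕ in Filter.atTop,
    Module.length A (M ⧸ (I ^ (n + 1) • ⊤ : Submodule A M)) ≠ ⊤ ∧
    ((Module.length A (M ⧸ (I ^ (n + 1) • ⊤ : Submodule A M))).toNat : ℤ) =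
      ∑ i : Fin (moduleDim A M + 1),
        (-1) ^ (i : ℕ) * e i * ((n + (moduleDim A M - i)).choose (moduleDim A M - i) : ℤ)

open Classical in
/-- The Hilbert coefficients `e_i(I, M)`. -/
def hilbertCoeff (i : Fin (moduleDim A M + 1)) : ℤ :=
  if h : ∃ e, IsHilbertCoeffs I M e then h.choose i else 0

variable (A) in
/-- The depth of a module over a local ring: the supremum of the lengths of the `M`-regular
sequences in the maximal ideal. -/
def moduleDepth [IsLocalRing A] : ℕ∞ :=
  ⨆ (rs : List A) (_ : ∀ x ∈ rs, x ∈ IsLocalRing.maximalIdeal A)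
    (_ : RingTheory.Sequence.IsRegular M rs), (rs.length : ℕ∞)

variable (A) in
/-- A nonzero finitely generated module over a local ring is Cohen–Macaulay if its depth equals
its dimension. -/
def IsCMModule [IsLocalRing A] : Prop :=
  Module.Finite A M ∧ (moduleDepth A M : WithBot ℕ∞) = Module.supportDim A M

end Local

end

/-! Everything rests on one element `x ∈ I`, regular on `M`, with `x I^n M = I^(n+1) M` for `n = e₀
- b`. Given it, multiplication by the initial form of `x` on `G_I(M)` is injective in degrees `≥ n`
and maps each such degree onto the next. Čech cohomology in degrees 0 and 1 then vanishes in all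
internal degrees `≥ n`, so `a₀, a₁ ≤ n - 1`. Also `G_I(M)` is finite over `(A/I)[X]`, with `X`
acting as that initial form, so its dimension is at most 1 and the regularity is at most `n`.

The element comes from an Eakin–Sathaye theorem for submodules
(`exists_span_singleton_smul_sup_eq`): if `I^(n+1) M` needs at most `n + 1` generators, then some `x
∈ I` satisfies `x I^n M = I^(n+1) M`. A first application yields a reduction `x` and identifies `e₀`
with `ℓ(M/xM)`, which bounds every `ℓ(I^k M / I^(k+1) M)`. Now put `J = I^(n+1) M` with `n = e₀ -
b`. From `IM ⊆ 𝔪^b M` follows `IJ ⊆ 𝔪^b J`, so `ℓ(J/𝔪^b J) ≤ e₀`. The part `𝔪J/𝔪^b J` has length at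
least `b - 1` by Nakayama, which leaves `ℓ(J/𝔪J) ≤ e₀ - b + 1 = n + 1`. A second application of
Eakin–Sathaye gives the required `x` (`exists_span_singleton_smul_pow_eq`). -/

/-! ### Generic perturbation of a surjection -/

section LinearAlgebra

/-- With a section `σ` of `φ`, it suffices that `id + t • ψσ` be bijective on the finite-dimensional
`W`. This holds for `t = -λ⁻¹` whenever `λ ≠ 0` is not an eigenvalue of `ψσ`, and an infinite field
contains such a `λ`. -/
lemma exists_ne_zero_surjective_add_smul {k K W : Type*} [Field k] [Infinite k] [AddCommGroup K]
    [Module k K] [AddCommGroup W] [Module k W] [FiniteDimensional k W] (φ ψ : K →ₗ[k] W)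
    (hφ : Function.Surjective φ) : ∃ t : k, t ≠ 0 ∧ Function.Surjective (φ + t • ψ) := by
  obtain ⟨σ, hσ⟩ := φ.exists_rightInverse_of_surjective (LinearMap.range_eq_top.2 hφ)
  set g : Module.End k W := ψ ∘ₗ σ with hg
  obtain ⟨t, ht⟩ := ((g.finite_hasEigenvalue).union (Set.finite_singleton 0)).infinite_compl.nonempty
  simp only [Set.mem_compl_iff, Set.mem_union, Set.mem_ofPred_eq, Set.mem_singleton_iff,
    not_or] at ht
  refine ⟨-t⁻¹, by simp [ht.2], ?_⟩
  have hinj : Function.Injective (LinearMap.id + (-t⁻¹) • g : W →ₗ[k] W) := by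
    rw [injective_iff_map_eq_zero]
    intro w hw
    by_contra hw0
    refine ht.1 (Module.End.hasEigenvalue_of_hasEigenvector ⟨?_, hw0⟩ (x := w))
    rw [Module.End.mem_eigenspace_iff]
    have h1 : w = t⁻¹ • g w := by
      simpa [add_neg_eq_zero] using hw
    conv_rhs => rw [h1]
    rw [smul_smul, mul_inv_cancel₀ ht.2, one_smul]
  have hsurj := LinearMap.surjective_of_injective hinj
  have : (LinearMap.id + (-t⁻¹) • g : W →ₗ[k] W) = (φ + (-t⁻¹) • ψ) ∘ₗ σ := by
    rw [LinearMap.add_comp, hσ, LinearMap.smul_comp]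
  rw [this] at hsurj
  exact Function.Surjective.of_comp (g := σ) (by simpa using hsurj)

-- Reduce modulo the maximal ideal, where the vector space version applies. A nonzero residue lifts
-- to a unit, and Nakayama lifts surjectivity.
open IsLocalRing in
lemma exists_isUnit_surjective_add_smul {A P W : Type*} [CommRing A] [IsLocalRing A]
    [Infinite (ResidueField A)] [AddCommGroup P] [Module A P] [AddCommGroup W] [Module A W]
    [Module.Finite A W] (φ ψ : P →ₗ[A] W) (hφ : Function.Surjective φ) :
    ∃ t : A, IsUnit t ∧ Function.Surjective (φ + t • ψ) := by
  let k := A ⧸ maximalIdeal A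
  have hsurj : Function.Surjective (algebraMap A k) := Ideal.Quotient.mk_surjective
  let _ : Field k := Ideal.Quotient.field _
  have : Infinite k := inferInstanceAs (Infinite (ResidueField A))
  have hle (χ : P →ₗ[A] W) : (maximalIdeal A • ⊤ : Submodule A P) ≤
      (maximalIdeal A • ⊤ : Submodule A W).comap χ := by
    rw [← Submodule.map_le_iff_le_comap, Submodule.map_smul'']
    exact Submodule.smul_mono le_rfl le_top
  let ext (χ : P →ₗ[A] W) : (P ⧸ (maximalIdeal A • ⊤ : Submodule A P)) →ₗ[k]
      (W ⧸ (maximalIdeal A • ⊤ : Submodule A W)) :=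
    (Submodule.mapQ _ _ χ (hle χ)).extendScalarsOfSurjective hsurj
  have hext (χ : P →ₗ[A] W) (p : P) : ext χ (Submodule.Quotient.mk p) =
    Submodule.Quotient.mk (χ p) := rfl
  have : Module.Finite k (W ⧸ (maximalIdeal A • ⊤ : Submodule A W)) :=
    Module.Finite.of_restrictScalars_finite A _ _
  have h1 : Function.Surjective (ext φ) := by
    intro w
    obtain ⟨w, rfl⟩ := Submodule.Quotient.mk_surjective _ w
    obtain ⟨p, rfl⟩ := hφ w
    exact ⟨_, hext φ p⟩
  obtain ⟨t, ht0, ht⟩ := exists_ne_zero_surjective_add_smul (ext φ) (ext ψ) h1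
  obtain ⟨t, rfl⟩ := hsurj t
  refine ⟨t, ?_, ?_⟩
  · by_contra h
    exact ht0 (Ideal.Quotient.eq_zero_iff_mem.2 ((mem_maximalIdeal t).2 h))
  · rw [← LinearMap.range_eq_top]
    refine top_le_iff.1 (Submodule.le_of_le_smul_of_le_jacobson_bot (I := maximalIdeal A)
      Module.Finite.fg_top (maximalIdeal_le_jacobson _) ?_)
    intro w _
    obtain ⟨p, hp⟩ := ht (Submodule.Quotient.mk w)
    obtain ⟨p, rfl⟩ := Submodule.Quotient.mk_surjective _ p
    have : (Submodule.Quotient.mk ((φ + t • ψ) p) : W ⧸ (maximalIdeal A • ⊤ : Submodule A W)) =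
      Submodule.Quotient.mk w := by
      rw [← hp]; rfl
    rw [Submodule.Quotient.eq] at this
    refine Submodule.mem_sup.2 ⟨_, ⟨p, rfl⟩, _, neg_mem this, ?_⟩
    abel

end LinearAlgebra

/-! ### Length of the image of a submodule in a quotient -/

section RelLength

variable {A M : Type*} [CommRing A] [AddCommGroup M] [Module A M]

/-- The length of the image of the submodule `P` of `M` in `M ⧸ Q`. -/
noncomputable def relLength (P Q : Submodule A M) : ℕ∞ := Module.length A (P.map Q.mkQ)

lemma map_mkQ_eq_bot_iff {P Q : Submodule A M} : P.map Q.mkQ = ⊥ ↔ P ≤ Q := by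
  rw [← le_bot_iff, Submodule.map_le_iff_le_comap, Submodule.comap_bot, Submodule.ker_mkQ]

lemma map_mkQ_sup (P Q : Submodule A M) : (P ⊔ Q).map Q.mkQ = P.map Q.mkQ := by
  rw [Submodule.map_sup, map_mkQ_eq_bot_iff.2 le_rfl, sup_bot_eq]

lemma relLength_sup (P Q : Submodule A M) : relLength (P ⊔ Q) Q = relLength P Q := by
  rw [relLength, map_mkQ_sup, relLength]

lemma relLength_eq_zero_iff {P Q : Submodule A M} : relLength P Q = 0 ↔ P ≤ Q := by
  rw [relLength, Module.length_eq_zero_iff, Submodule.subsingleton_iff_eq_bot,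
    map_mkQ_eq_bot_iff]

lemma relLength_mono {P P' : Submodule A M} (Q : Submodule A M) (h : P ≤ P') :
    relLength P Q ≤ relLength P' Q :=
  Module.length_le_of_injective (Submodule.inclusion (Submodule.map_mono h))
    (Submodule.inclusion_injective _)

lemma relLength_top (Q : Submodule A M) : relLength ⊤ Q = Module.length A (M ⧸ Q) := by
  rw [relLength, Submodule.map_top, Submodule.range_mkQ, Module.length_top]

lemma relLength_add {P Q R : Submodule A M} (hQP : Q ≤ P) (hRQ : R ≤ Q) :
    relLength Q R + relLength P Q = relLength P R := by
  let q : (M ⧸ R) →ₗ[A] (M ⧸ Q) := R.mapQ Q LinearMap.id hRQ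
  have hq (p : M) : q (R.mkQ p) = Q.mkQ p := rfl
  let g : P.map R.mkQ →ₗ[A] P.map Q.mkQ := q.restrict (by
    rintro _ ⟨p, hp, rfl⟩
    exact ⟨p, hp, rfl⟩)
  refine (Module.length_eq_add_of_exact (Submodule.inclusion (Submodule.map_mono hQP)) g
    (Submodule.inclusion_injective _) ?_ ?_).symm
  · rintro ⟨_, p, hp, rfl⟩
    exact ⟨⟨_, p, hp, rfl⟩, rfl⟩
  · rintro ⟨_, p, hp, rfl⟩
    constructor
    · intro h
      have h : Q.mkQ p = 0 := congrArg Subtype.val h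
      have hpQ : p ∈ Q := by simpa using h
      exact ⟨⟨_, p, hpQ, rfl⟩, rfl⟩
    · rintro ⟨⟨_, r, hr, rfl⟩, h⟩
      have h : R.mkQ r = R.mkQ p := congrArg Subtype.val h
      refine Subtype.ext ?_
      change q (R.mkQ p) = 0
      rw [← h, hq]
      simpa using hr

/-- By additivity the quotient `(P' ⊔ Q)/(P ⊔ Q)` has length zero; finiteness permits the
cancellation. -/
lemma sup_eq_sup_of_relLength_le {P P' Q : Submodule A M} (h : P ≤ P')
    (hfin : relLength P' Q ≠ ⊤) (hle : relLength P' Q ≤ relLength P Q) : P ⊔ Q = P' ⊔ Q := by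
  have h1 := relLength_add (sup_le_sup_right h Q) (le_sup_right : Q ≤ P ⊔ Q)
  rw [relLength_sup, relLength_sup] at h1
  refine le_antisymm (sup_le_sup_right h Q) (relLength_eq_zero_iff.1 ?_)
  have hP : relLength P Q ≠ ⊤ := ne_top_of_le_ne_top hfin (relLength_mono Q h)
  rw [← h1] at hle
  have : relLength P Q + relLength (P' ⊔ Q) (P ⊔ Q) ≤ relLength P Q + 0 := by simpa using hle
  exact le_antisymm ((ENat.add_le_add_iff_left hP).1 this) bot_le

lemma mem_span_singleton_smul {x : A} {P : Submodule A M} {m : M} :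
    m ∈ Ideal.span {x} • P ↔ ∃ p ∈ P, x • p = m := by
  rw [Submodule.ideal_span_singleton_smul]
  rfl

lemma relLength_span_singleton_smul {x : A} (hx : IsSMulRegular M x) {P Q : Submodule A M} :
    relLength (Ideal.span {x} • P) (Ideal.span {x} • Q) = relLength P Q := by
  let q : (M ⧸ Q) →ₗ[A] (M ⧸ (Ideal.span {x} • Q : Submodule A M)) :=
    Q.mapQ _ (LinearMap.lsmul A M x) (fun m hm => mem_span_singleton_smul.2 ⟨m, hm, rfl⟩)
  have hq (m : M) : q (Submodule.Quotient.mk m) = Submodule.Quotient.mk (x • m) := rfl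
  have hmem : ∀ a ∈ P.map Q.mkQ, q a ∈ (Ideal.span {x} • P).map (Ideal.span {x} • Q).mkQ := by
    rintro _ ⟨p, hp, rfl⟩
    exact ⟨x • p, mem_span_singleton_smul.2 ⟨p, hp, rfl⟩, rfl⟩
  refine (LinearEquiv.length_eq (LinearEquiv.ofBijective (q.restrict hmem) ⟨?_, ?_⟩)).symm
  · rw [injective_iff_map_eq_zero]
    rintro ⟨_, p, hp, rfl⟩ h
    have h : q (Submodule.Quotient.mk p) = 0 := congrArg Subtype.val h
    rw [hq, Submodule.Quotient.mk_eq_zero, mem_span_singleton_smul] at h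
    obtain ⟨p', hp', h⟩ := h
    obtain rfl := hx h
    refine Subtype.ext ?_
    simpa using hp'
  · rintro ⟨_, _, hr, rfl⟩
    obtain ⟨p, hp, rfl⟩ := mem_span_singleton_smul.1 hr
    exact ⟨⟨_, p, hp, rfl⟩, rfl⟩

end RelLength

/-! ### The Eakin–Sathaye theorem for submodules -/

section EakinSathaye

variable {A M : Type*} [CommRing A] [IsLocalRing A] [Infinite (IsLocalRing.ResidueField A)]
  [AddCommGroup M] [Module A M]

/-- Multiplications by `x` and `v` induce maps from `P` to the image of `T` in `M/N`, the first one
onto, so the perturbation lemma applies. -/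
lemma exists_isUnit_span_add_smul_sup_eq {P T N : Submodule A M} {x v : A}
    (hfin : relLength T N ≠ ⊤) (hx : Ideal.span {x} • P ⊔ N = T ⊔ N)
    (hv : Ideal.span {v} • P ≤ T ⊔ N) :
    ∃ t : A, IsUnit t ∧ Ideal.span {x + t * v} • P ⊔ N = T ⊔ N := by
  have hfl := isFiniteLength_iff_isNoetherian_isArtinian.1 (Module.length_ne_top_iff.1 hfin)
  have := hfl.1
  have hmap : (T ⊔ N).map N.mkQ = T.map N.mkQ := map_mkQ_sup T N
  have hmem (y : A) (hy : Ideal.span {y} • P ≤ T ⊔ N) (p : P) : N.mkQ (y • (p : M)) ∈ T.map N.mkQ := by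
    rw [← hmap]
    exact ⟨_, hy (mem_span_singleton_smul.2 ⟨p, p.2, rfl⟩), rfl⟩
  let φ (y : A) (hy : Ideal.span {y} • P ≤ T ⊔ N) : P →ₗ[A] T.map N.mkQ :=
    LinearMap.codRestrict _ (N.mkQ ∘ₗ LinearMap.lsmul A M y ∘ₗ P.subtype) (hmem y hy)
  have hx' : Ideal.span {x} • P ≤ T ⊔ N := hx ▸ le_sup_left
  have hsurj : Function.Surjective (φ x hx') := by
    rintro ⟨_, w, hw, rfl⟩
    have : w ∈ Ideal.span {x} • P ⊔ N := hx ▸ Submodule.mem_sup_left hw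
    obtain ⟨_, h1, z, hz, rfl⟩ := Submodule.mem_sup.1 this
    obtain ⟨p, hp, rfl⟩ := mem_span_singleton_smul.1 h1
    refine ⟨⟨p, hp⟩, Subtype.ext ?_⟩
    change N.mkQ (x • p) = N.mkQ (x • p + z)
    rw [map_add, (Submodule.Quotient.mk_eq_zero N (x := z)).2 hz |> (id : _ → N.mkQ z = 0), add_zero]
  obtain ⟨t, ht, hs⟩ := exists_isUnit_surjective_add_smul (φ x hx') (φ v hv) hsurj
  refine ⟨t, ht, le_antisymm (sup_le ?_ le_sup_right) (sup_le ?_ le_sup_right)⟩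
  · intro m hm
    obtain ⟨p, hp, rfl⟩ := mem_span_singleton_smul.1 hm
    rw [add_smul, mul_smul]
    exact add_mem (hx' (mem_span_singleton_smul.2 ⟨p, hp, rfl⟩))
      (Submodule.smul_mem _ _ (hv (mem_span_singleton_smul.2 ⟨p, hp, rfl⟩)))
  · intro m hm
    obtain ⟨p, hp⟩ := hs ⟨N.mkQ m, m, hm, rfl⟩
    have hp : N.mkQ ((x + t * v) • (p : M)) = N.mkQ m := by
      rw [add_smul, mul_smul, map_add, map_smul N.mkQ t]
      exact congrArg Subtype.val hp
    have := (Submodule.Quotient.eq N).1 hp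
    refine Submodule.mem_sup.2 ⟨_, mem_span_singleton_smul.2 ⟨p, p.2, rfl⟩, _, neg_mem this, ?_⟩
    abel

/-- A theorem of Eakin and Sathaye, for submodules. -/
theorem exists_span_singleton_smul_sup_eq (I : Ideal A) (N : Submodule A M) (n : ℕ)
    (U : Submodule A M) (h : relLength (I ^ (n + 1) • U) N ≤ n + 1) :
    ∃ x ∈ I, Ideal.span {x} • (I ^ n • U) ⊔ N = I ^ (n + 1) • U ⊔ N := by
  induction n generalizing U with
  | zero =>
    -- The image of `IU` has length at most 1, so any `x` with nonzero image already fills it; if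
    -- every image is zero, `x = 0` works.
    by_contra! hcon
    have hz : ∀ x ∈ I, Ideal.span {x} • U ≤ N := by
      intro x hx
      by_contra hxN
      have hle : Ideal.span {x} • U ≤ I ^ (0 + 1) • U := by
        rw [zero_add, pow_one]
        exact Submodule.smul_mono_left ((Ideal.span_singleton_le_iff_mem I).2 hx)
      refine hcon x hx ?_
      rw [pow_zero, one_smul]
      refine sup_eq_sup_of_relLength_le hle (ne_top_of_le_ne_top (by simp) h) (h.trans ?_)
      simp only [Nat.cast_zero, zero_add]
      exact Order.one_le_iff_ne_zero.2 (fun h0 => hxN (relLength_eq_zero_iff.1 h0))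
    refine hcon 0 I.zero_mem ?_
    have : I ^ (0 + 1) • U ≤ N := by
      rw [zero_add, pow_one, Submodule.smul_le]
      exact fun x hx u hu => hz x hx (mem_span_singleton_smul.2 ⟨u, hu, rfl⟩)
    rw [sup_eq_right.2 this, sup_eq_right]
    rw [pow_zero, one_smul]
    exact hz 0 I.zero_mem
  | succ k ih =>
    set T := I ^ (k + 1 + 1) • U with hT
    set P := I ^ (k + 1) • U with hP
    have hTP : T = I • P := by rw [hT, hP, pow_succ', Submodule.mul_smul]
    have hle (x : A) (hx : x ∈ I) : Ideal.span {x} • P ≤ T := by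
      rw [hTP]
      exact Submodule.smul_mono_left ((Ideal.span_singleton_le_iff_mem I).2 hx)
    have hfin : relLength T N ≠ ⊤ := ne_top_of_le_ne_top (by exact_mod_cast ENat.natCast_ne_top (k + 1 + 1)) h
    have hfin' (x : A) (hx : x ∈ I) : relLength (Ideal.span {x} • P) N ≠ ⊤ :=
      ne_top_of_le_ne_top hfin (relLength_mono N (hle x hx))
    -- Choose `x` so that the image of `xP` in `M/N` is as long as possible. If it is not all of
    -- `T`, its length drops to at most `k + 1`, and induction applies to `xU`.
    obtain ⟨x, hx, hmax⟩ : ∃ x ∈ I, ∀ y ∈ I,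
        relLength (Ideal.span {y} • P) N ≤ relLength (Ideal.span {x} • P) N := by
      let S : Set ℕ := (fun x => (relLength (Ideal.span {x} • P) N).toNat) '' (I : Set A)
      have hS : S.Nonempty := ⟨_, 0, I.zero_mem, rfl⟩
      have hb : BddAbove S := by
        refine ⟨(relLength T N).toNat, ?_⟩
        rintro _ ⟨x, hx, rfl⟩
        exact ENat.toNat_le_toNat (relLength_mono N (hle x hx)) hfin
      obtain ⟨x, hx, hxS⟩ := Nat.sSup_mem hS hb
      refine ⟨x, hx, fun y hy => ?_⟩
      rw [← ENat.natCast_toNat (hfin' x hx), ← ENat.natCast_toNat (hfin' y hy)]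
      have := le_csSup hb ⟨y, hy, rfl⟩
      rw [← hxS] at this
      exact_mod_cast this
    refine ⟨x, hx, ?_⟩
    by_contra hne
    have hlt : relLength (Ideal.span {x} • P) N < relLength T N := by
      by_contra hcon
      exact hne (sup_eq_sup_of_relLength_le (hle x hx) hfin (not_lt.1 hcon))
    have hcomm (J : Ideal A) (V : Submodule A M) :
        J • (Ideal.span {x} • V) = Ideal.span {x} • (J • V) := by
      rw [← Submodule.mul_smul, mul_comm, Submodule.mul_smul]
    have hU' : relLength (I ^ (k + 1) • (Ideal.span {x} • U)) N ≤ k + 1 := by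
      rw [hcomm (I ^ (k + 1)) U]
      have h2 := hlt.trans_le h
      rw [Nat.cast_add, Nat.cast_one] at h2
      exact ENat.lt_add_one_iff (by exact_mod_cast ENat.natCast_ne_top (k + 1)) |>.1 h2
    obtain ⟨y, hy, hyeq⟩ := ih (Ideal.span {x} • U) hU'
    rw [hcomm (I ^ (k + 1)) U, hcomm (I ^ k) U] at hyeq
    have hsub : Ideal.span {x} • (I ^ k • U) ≤ P := by
      rw [hP, pow_succ', Submodule.mul_smul]
      exact Submodule.smul_mono_left ((Ideal.span_singleton_le_iff_mem I).2 hx)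
    -- every element of `I` giving equality in the smaller problem has the same image as `x`
    have good (z : A) (hz : z ∈ I) (hzeq : Ideal.span {z} • (Ideal.span {x} • (I ^ k • U)) ⊔ N =
        Ideal.span {x} • P ⊔ N) : Ideal.span {z} • P ≤ Ideal.span {x} • P ⊔ N := by
      have h1 : Ideal.span {x} • P ⊔ N ≤ Ideal.span {z} • P ⊔ N := by
        rw [← hzeq]
        exact sup_le_sup_right (Submodule.smul_mono le_rfl hsub) N
      have h2 := sup_eq_sup_of_relLength_le (Q := N) h1 (by rw [relLength_sup]; exact hfin' z hz)
        (by rw [relLength_sup, relLength_sup]; exact hmax z hz)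
      rw [sup_assoc, sup_assoc, sup_idem] at h2
      exact h2 ▸ le_sup_left
    have hyP := good y hy hyeq
    -- Both `y` and a perturbation `y + tv` with `t` a unit solve the smaller problem, so both carry
    -- `P` into `xP + N`. Subtracting puts `vP` there too, for every `v ∈ I`, which forces `T ≤ xP +
    -- N`.
    have hall : ∀ v ∈ I, Ideal.span {v} • P ≤ Ideal.span {x} • P ⊔ N := by
      intro v hv
      obtain ⟨t, ht, hteq⟩ := exists_isUnit_span_add_smul_sup_eq (v := v) (hfin' x hx) hyeq (by
        refine le_trans ?_ le_sup_left
        rw [hcomm (Ideal.span {v}) (I ^ k • U)]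
        refine Submodule.smul_mono le_rfl ?_
        rw [hP, pow_succ', Submodule.mul_smul]
        exact Submodule.smul_mono_left ((Ideal.span_singleton_le_iff_mem I).2 hv))
      have hz := good _ (I.add_mem hy (I.mul_mem_left t hv)) hteq
      intro m hm
      obtain ⟨p, hp, rfl⟩ := mem_span_singleton_smul.1 hm
      have h1 := hz (mem_span_singleton_smul.2 ⟨p, hp, rfl⟩)
      have h2 := hyP (mem_span_singleton_smul.2 ⟨p, hp, rfl⟩)
      have h3 := sub_mem h1 h2
      rw [add_smul, add_sub_cancel_left, mul_smul] at h3
      obtain ⟨u, rfl⟩ := ht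
      simpa [smul_smul] using Submodule.smul_mem _ (↑u⁻¹ : A) h3
    refine hne (le_antisymm (sup_le_sup_right (hle x hx) N) (sup_le ?_ le_sup_right))
    rw [hTP, Submodule.smul_le]
    exact fun v hv p hp => hall v hv (mem_span_singleton_smul.2 ⟨p, hp, rfl⟩)

end EakinSathaye

/-! ### A regular parameter in `I` -/

section FiniteLength

open IsLocalRing

variable {A M : Type*} [CommRing A] [IsNoetherianRing A] [IsLocalRing A] [AddCommGroup M] [Module A M]

lemma isArtinianRing_quotient_of_radical_eq {I : Ideal A} (hI : I.radical = maximalIdeal A) :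
    IsArtinianRing (A ⧸ I) := by
  refine quotient_artinian_of_mem_minimalPrimes_of_isLocalRing I ?_
  rw [← Ideal.radical_minimalPrimes, hI, Ideal.minimalPrimes_eq_subsingleton_self]
  rfl

lemma length_ne_top_of_le_annihilator [Module.Finite A M] {J : Ideal A}
    (hJ : J.radical = maximalIdeal A) (h : J ≤ Module.annihilator A M) :
    Module.length A M ≠ ⊤ := by
  have hM : Module.IsTorsionBySet A M J := fun m a => Module.mem_annihilator.1 (h a.2) m
  let _ := hM.module
  have := isArtinianRing_quotient_of_radical_eq hJ
  have : Module.Finite (A ⧸ J) M := Module.Finite.of_restrictScalars_finite A _ _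
  rw [Module.length_eq_of_surjective (R := A ⧸ J) Ideal.Quotient.mk_surjective]
  exact Module.length_ne_top

/-- Depth one supplies a regular `z ∈ 𝔪`, and a power `y` of it lies in `I`. Dividing by `y` lowers
the dimension to 0, so the annihilator of `M/yM` is `𝔪`-primary. -/
lemma exists_isSMulRegular_mem_length_ne_top {I : Ideal A} (hI : I.radical = maximalIdeal A)
    (hM : IsCMModule A M) (hdim : Module.supportDim A M = 1) :
    ∃ y ∈ I, IsSMulRegular M y ∧ Module.length A (M ⧸ (Ideal.span {y} • ⊤ : Submodule A M)) ≠ ⊤ := by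
  obtain ⟨hfin, hdepth⟩ := hM
  rw [hdim] at hdepth
  have hdepth : moduleDepth A M = 1 := by exact_mod_cast hdepth
  obtain ⟨z, hz, hreg⟩ : ∃ z ∈ maximalIdeal A, IsSMulRegular M z := by
    have h0 : (0 : ℕ∞) < moduleDepth A M := by rw [hdepth]; exact zero_lt_one
    rw [moduleDepth] at h0
    simp only [lt_iSup_iff] at h0
    obtain ⟨rs, hmem, hrs, hlen⟩ := h0
    match rs, hmem, hrs, hlen with
    | [], _, _, h => simp at h
    | z :: rs, hmem, hrs, _ =>
      exact ⟨z, hmem z (by simp), ((RingTheory.Sequence.isRegular_cons_iff _ _ _).1 hrs).1⟩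
  have hzI : z ∈ I.radical := hI ▸ hz
  obtain ⟨k, hk⟩ := hzI
  have hreg' : IsSMulRegular M (z ^ (k + 1)) := hreg.pow _
  -- The extra factor keeps `y` in the maximal ideal even when `k = 0`.
  set y := z ^ (k + 1) with hy
  have hym : y ∈ maximalIdeal A := Ideal.pow_mem_of_mem _ hz _ (Nat.succ_pos k)
  refine ⟨y, by rw [hy, pow_succ]; exact I.mul_mem_right _ hk, hreg', ?_⟩
  have h1 := Module.supportDim_quotSMulTop_succ_eq_supportDim hreg' hym
  rw [hdim] at h1
  have h2 : Module.supportDim A (QuotSMulTop y M) = 0 := by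
    generalize Module.supportDim A (QuotSMulTop y M) = d at h1
    match d, h1 with
    | ⊥, h => simp at h
    | (d : ℕ∞), h =>
      have h : d + 1 = 0 + 1 := by rw [zero_add]; exact_mod_cast h
      have : d = 0 := ENat.add_left_injective_of_ne_top (by simp) h
      rw [this]; rfl
  have h3 := support_of_supportDim_eq_zero A _ h2
  rw [Module.support_eq_zeroLocus, PrimeSpectrum.zeroLocus_eq_iff,
    (maximalIdeal.isMaximal A).isPrime.radical] at h3
  have h4 := length_ne_top_of_le_annihilator (M := QuotSMulTop y M) h3 le_rfl
  rwa [Submodule.ideal_span_singleton_smul]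

end FiniteLength

/-! ### Colengths of `I^n M` and reductions -/

section Reduction

variable {A M : Type*} [CommRing A] [AddCommGroup M] [Module A M]

lemma relLength_anti (P : Submodule A M) {Q R : Submodule A M} (hQP : Q ≤ P) (h : R ≤ Q) :
    relLength P Q ≤ relLength P R := by
  rw [← relLength_add hQP h]
  exact le_add_self

lemma span_singleton_smul_le {I : Ideal A} {x : A} (hx : x ∈ I) (P : Submodule A M) :
    Ideal.span {x} • P ≤ I • P :=
  Submodule.smul_mono_left ((Ideal.span_singleton_le_iff_mem I).2 hx)

/-- Compute `ℓ(M/xP)` through `P` and through `xM`, and cancel `ℓ(xM/xP) = ℓ(M/P)`. -/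
lemma relLength_span_singleton_smul_self {x : A} (hx : IsSMulRegular M x) {P : Submodule A M}
    (hP : relLength ⊤ P ≠ ⊤) :
    relLength P (Ideal.span {x} • P) = relLength ⊤ (Ideal.span {x} • ⊤ : Submodule A M) := by
  have h1 := relLength_add (le_top : P ≤ ⊤) (Submodule.smul_le_right : Ideal.span {x} • P ≤ P)
  have h2 := relLength_add (le_top : Ideal.span {x} • ⊤ ≤ ⊤)
    (Submodule.smul_mono le_rfl le_top : Ideal.span {x} • P ≤ Ideal.span {x} • ⊤)
  rw [← h1, relLength_span_singleton_smul hx, add_comm] at h2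
  exact (ENat.add_left_injective_of_ne_top hP h2).symm

/-- The kernels of the `x^i` stabilize at some `i`. If `xm = 0`, write `y^(ci) m = x^i m'`; then
`x^(i+1) m' = 0`, so `x^i m' = 0` and `m = 0` because `y` is regular. -/
lemma isSMulRegular_of_pow_smul_mem [IsNoetherian A M] {x y : A} (hy : IsSMulRegular M y) (c : ℕ)
    (h : ∀ m : M, ∃ m' : M, x • m' = y ^ c • m) : IsSMulRegular M x := by
  have hpow (i : ℕ) : ∀ m : M, ∃ m' : M, x ^ i • m' = (y ^ c) ^ i • m := by
    induction i with
    | zero => exact fun m => ⟨m, by simp⟩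
    | succ i ih =>
      intro m
      obtain ⟨m₁, h₁⟩ := ih m
      obtain ⟨m₂, h₂⟩ := h m₁
      exact ⟨m₂, by rw [pow_succ, mul_smul, h₂, smul_comm, h₁, smul_smul, ← pow_succ']⟩
  let K : ℕ →o Submodule A M := ⟨fun i => LinearMap.ker (LinearMap.lsmul A M (x ^ i)), by
    refine monotone_nat_of_le_succ fun i m hm => ?_
    have hm : x ^ i • m = 0 := hm
    change x ^ (i + 1) • m = 0
    rw [pow_succ', mul_smul, hm, smul_zero]⟩
  obtain ⟨i, hi⟩ := monotone_stabilizes_iff_noetherian.2 ‹IsNoetherian A M› K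
  have hi : K i = K (i + 1) := hi (i + 1) i.le_succ
  rw [isSMulRegular_iff_right_eq_zero_of_smul]
  intro m hm
  obtain ⟨m', hm'⟩ := hpow i m
  have h1 : m' ∈ K (i + 1) := by
    change x ^ (i + 1) • m' = 0
    rw [pow_succ', mul_smul, hm', smul_comm, hm, smul_zero]
  rw [← hi] at h1
  have h1 : x ^ i • m' = 0 := h1
  rw [hm'] at h1
  exact (isSMulRegular_iff_right_eq_zero_of_smul.1 ((hy.pow c).pow i)) m h1

lemma pow_smul_mem_pow_smul_top {I : Ideal A} {y : A} (hy : y ∈ I) (n : ℕ) (m : M) :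
    y ^ n • m ∈ (I ^ n • ⊤ : Submodule A M) :=
  Submodule.smul_mem_smul (Ideal.pow_mem_pow hy n) trivial

lemma pow_succ_smul (I : Ideal A) (n : ℕ) (U : Submodule A M) :
    I ^ (n + 1) • U = I • (I ^ n • U) := by
  rw [pow_succ', Submodule.mul_smul]

lemma relLength_pow_smul_ne_top {I : Ideal A} [IsNoetherian A M] {y : A} (hy : y ∈ I)
    (hreg : IsSMulRegular M y)
    (hfin : Module.length A (M ⧸ (Ideal.span {y} • ⊤ : Submodule A M)) ≠ ⊤) (n : ℕ) :
    relLength ⊤ (I ^ n • ⊤ : Submodule A M) ≠ ⊤ := by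
  induction n with
  | zero =>
    rw [relLength_eq_zero_iff.2 (by simp)]
    simp
  | succ n ih =>
    rw [pow_succ_smul, ← relLength_add le_top Submodule.smul_le_right]
    refine WithTop.add_ne_top.2 ⟨?_, ih⟩
    refine ne_top_of_le_ne_top ?_
      (relLength_anti _ Submodule.smul_le_right (span_singleton_smul_le hy _))
    rw [relLength_span_singleton_smul_self hreg ih, relLength_top]
    exact hfin

lemma relLength_pow_smul_le {I : Ideal A} {x : A} (hx : x ∈ I)
    (hreg : IsSMulRegular M x) {n : ℕ} (hn : relLength ⊤ (I ^ n • ⊤ : Submodule A M) ≠ ⊤) :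
    relLength (I ^ n • ⊤ : Submodule A M) (I ^ (n + 1) • ⊤) ≤
      relLength ⊤ (Ideal.span {x} • ⊤ : Submodule A M) := by
  rw [← relLength_span_singleton_smul_self hreg hn, pow_succ_smul]
  exact relLength_anti _ Submodule.smul_le_right (span_singleton_smul_le hx _)

lemma isSMulRegular_of_pow_succ_smul_eq {I : Ideal A} [IsNoetherian A M] {x y : A} (hy : y ∈ I)
    (hreg : IsSMulRegular M y) {n : ℕ}
    (h : Ideal.span {x} • (I ^ n • ⊤ : Submodule A M) = I ^ (n + 1) • ⊤) : IsSMulRegular M x := by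
  refine isSMulRegular_of_pow_smul_mem hreg (n + 1) fun m => ?_
  have := pow_smul_mem_pow_smul_top hy (n + 1) m
  rw [← h, mem_span_singleton_smul] at this
  obtain ⟨p, -, hp⟩ := this
  exact ⟨p, hp⟩

lemma pow_succ_smul_eq_of_le {I : Ideal A} {x : A} {n : ℕ}
    (h : Ideal.span {x} • (I ^ n • ⊤ : Submodule A M) = I ^ (n + 1) • ⊤) (k : ℕ) :
    Ideal.span {x} • (I ^ (n + k) • ⊤ : Submodule A M) = I ^ (n + k + 1) • ⊤ := by
  induction k with
  | zero => exact h
  | succ k ih =>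
    rw [← add_assoc, pow_succ_smul I (n + k), ← Submodule.mul_smul, mul_comm, Submodule.mul_smul, ih,
      ← pow_succ_smul]

lemma relLength_top_pow_smul_add {I : Ideal A} {x : A} {n : ℕ} (hreg : IsSMulRegular M x)
    (hfin : ∀ n, relLength ⊤ (I ^ n • ⊤ : Submodule A M) ≠ ⊤)
    (h : Ideal.span {x} • (I ^ n • ⊤ : Submodule A M) = I ^ (n + 1) • ⊤) (k : ℕ) :
    relLength ⊤ (I ^ (n + k) • ⊤ : Submodule A M) = relLength ⊤ (I ^ n • ⊤ : Submodule A M) +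
      k * relLength ⊤ (Ideal.span {x} • ⊤ : Submodule A M) := by
  induction k with
  | zero => simp
  | succ k ih =>
    have h1 := relLength_add (le_top : (I ^ (n + k) • ⊤ : Submodule A M) ≤ ⊤)
      (Submodule.smul_le_right : Ideal.span {x} • (I ^ (n + k) • ⊤ : Submodule A M) ≤ _)
    rw [relLength_span_singleton_smul_self hreg (hfin _), pow_succ_smul_eq_of_le h, ih] at h1
    rw [← add_assoc, ← h1]
    push_cast
    ring

end Reduction

/-! ### The coefficient `e₀` as the colength of a reduction -/

section HilbertCoeff

variable {A M : Type*} [CommRing A] [AddCommGroup M] [Module A M]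

lemma sum_hilbert_dim_one {r : ℕ} (hr : r = 1) (e : Fin (r + 1) → ℤ) (n : ℕ) :
    ∑ i : Fin (r + 1), (-1) ^ (i : ℕ) * e i * ((n + (r - i)).choose (r - i) : ℤ) =
      e 0 * (n + 1) - e (Fin.last r) := by
  subst hr
  rw [Fin.sum_univ_two]
  simp
  ring

lemma moduleDim_eq_one (hdim : Module.supportDim A M = 1) : moduleDim A M = 1 := by
  rw [moduleDim, hdim]; rfl

/-- From exponent `n` on, each further power of `I` adds `ℓ(M/xM)` to the colength, so this number
is the slope of the Hilbert polynomial. -/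
lemma hilbertCoeff_zero_eq {I : Ideal A} {x : A} {n : ℕ} (hdim : Module.supportDim A M = 1)
    (hreg : IsSMulRegular M x)
    (hx : relLength ⊤ (Ideal.span {x} • ⊤ : Submodule A M) ≠ ⊤)
    (hfin : ∀ n, relLength ⊤ (I ^ n • ⊤ : Submodule A M) ≠ ⊤)
    (h : Ideal.span {x} • (I ^ n • ⊤ : Submodule A M) = I ^ (n + 1) • ⊤) :
    hilbertCoeff I M 0 = (relLength ⊤ (Ideal.span {x} • ⊤ : Submodule A M)).toNat := by
  have hd := moduleDim_eq_one hdim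
  set a := (relLength ⊤ (Ideal.span {x} • ⊤ : Submodule A M)).toNat with ha
  obtain ⟨l, hl⟩ := ENat.ne_top_iff_exists.1 (hfin n)
  have hlen (k : ℕ) : (Module.length A (M ⧸ (I ^ (n + k + 1) • ⊤ : Submodule A M))).toNat =
      l + (k + 1) * a := by
    rw [← relLength_top, add_assoc, relLength_top_pow_smul_add hreg hfin h, ← hl,
      ← ENat.natCast_toNat hx, ← ha]
    exact_mod_cast ENat.toNat_natCast _
  have hlen' {m : ℕ} (hm : n ≤ m) :
      ((Module.length A (M ⧸ (I ^ (m + 1) • ⊤ : Submodule A M))).toNat : ℤ) =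
      l + (m - n + 1) * a := by
    obtain ⟨k, rfl⟩ := Nat.exists_eq_add_of_le hm
    rw [hlen]
    push_cast
    ring
  have hex : ∃ e, IsHilbertCoeffs I M e := by
    -- The value of `e₁` is read off from `l + (m - n + 1) a = a (m + 1) - (n a - l)`.
    refine ⟨fun i => if i = 0 then a else n * a - l, ?_⟩
    filter_upwards [Filter.eventually_ge_atTop n] with m hm
    refine ⟨by rw [← relLength_top]; exact hfin _, ?_⟩
    rw [sum_hilbert_dim_one hd, hlen' hm, if_pos rfl, if_neg]
    · ring
    · intro h0
      have := congrArg Fin.val h0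
      simp [hd] at this
  rw [hilbertCoeff, dif_pos hex]
  have hspec := hex.choose_spec
  set e := hex.choose
  obtain ⟨m, hm⟩ := Filter.eventually_atTop.1 hspec
  -- The coefficients were chosen arbitrarily; comparing two consecutive values determines the
  -- slope.
  have h1 := (hm (max m n) (le_max_left _ _)).2
  have h2 := (hm (max m n + 1) ((le_max_left _ _).trans (Nat.le_succ _))).2
  rw [sum_hilbert_dim_one hd, hlen' (le_max_right _ _)] at h1
  rw [sum_hilbert_dim_one hd, hlen' ((le_max_right _ _).trans (Nat.le_succ _))] at h2
  push_cast at h1 h2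
  linarith

end HilbertCoeff

/-! ### Reduction number at most `e₀ - b` -/

section Main

open IsLocalRing

variable {A M : Type*} [CommRing A] [IsNoetherianRing A] [IsLocalRing A] [AddCommGroup M] [Module A M]

-- By Nakayama each layer `𝔪^i J / 𝔪^(i+1) J` with `𝔪^i J ≠ 0` is nonzero and adds at least 1.
omit [IsNoetherianRing A] in
lemma le_relLength_maximalIdeal_pow_smul [IsNoetherian A M] (J : Submodule A M) (k : ℕ)
    (h : ∀ i < k, maximalIdeal A ^ i • J ≠ ⊥) : (k : ℕ∞) ≤ relLength J (maximalIdeal A ^ k • J) := by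
  induction k with
  | zero => simp
  | succ k ih =>
    rw [pow_succ_smul, ← relLength_add Submodule.smul_le_right Submodule.smul_le_right,
      add_comm (relLength _ _)]
    push_cast
    refine add_le_add (ih fun i hi => h i (hi.trans k.lt_succ_self)) ?_
    rw [Order.one_le_iff_ne_zero]
    intro h0
    exact h k k.lt_succ_self (Submodule.eq_bot_of_le_smul_of_le_jacobson_bot _ _
      (IsNoetherian.noetherian _) (relLength_eq_zero_iff.1 h0) (maximalIdeal_le_jacobson _))

theorem exists_span_singleton_smul_pow_eq [Infinite (ResidueField A)] {I : Ideal A}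
    (hI : I.radical = maximalIdeal A) (hM : IsCMModule A M) (hdim : Module.supportDim A M = 1)
    {b : ℕ} (hb0 : 1 ≤ b) (hb : I • (⊤ : Submodule A M) ≤ maximalIdeal A ^ b • ⊤) :
    ∃ n : ℕ, (n : ℤ) = hilbertCoeff I M 0 - b ∧ ∃ x ∈ I, IsSMulRegular M x ∧
      Ideal.span {x} • (I ^ n • ⊤ : Submodule A M) = I ^ (n + 1) • ⊤ := by
  obtain ⟨y, hyI, hyreg, hyfin⟩ := exists_isSMulRegular_mem_length_ne_top hI hM hdim
  have := hM.1
  have hIm : I ≤ maximalIdeal A := hI ▸ Ideal.le_radical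
  have hnt : Nontrivial M := by simp [← Module.supportDim_ne_bot_iff_nontrivial A, hdim]
  have hfin := relLength_pow_smul_ne_top hyI hyreg hyfin
  -- Eakin–Sathaye modulo `𝔪 I^(n+1) M`; Nakayama turns the congruence into an equality, and `x`
  -- inherits regularity from `y`.
  have nakayama (n : ℕ) (h : relLength (I ^ (n + 1) • ⊤ : Submodule A M)
      (maximalIdeal A • (I ^ (n + 1) • ⊤)) ≤ n + 1) : ∃ x ∈ I, IsSMulRegular M x ∧
        Ideal.span {x} • (I ^ n • ⊤ : Submodule A M) = I ^ (n + 1) • ⊤ := by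
    obtain ⟨x, hx, hxn⟩ := exists_span_singleton_smul_sup_eq I _ n ⊤ h
    have h1 : Ideal.span {x} • (I ^ n • ⊤ : Submodule A M) = I ^ (n + 1) • ⊤ := by
      refine le_antisymm ?_ (Submodule.le_of_le_smul_of_le_jacobson_bot
        (IsNoetherian.noetherian _) (maximalIdeal_le_jacobson _) (hxn.ge.trans' le_sup_left))
      rw [pow_succ_smul]
      exact span_singleton_smul_le hx _
    exact ⟨x, hx, isSMulRegular_of_pow_succ_smul_eq hyI hyreg h1, h1⟩
  have hsmul (n : ℕ) : I ^ (n + 1 + 1) • (⊤ : Submodule A M) ≤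
      maximalIdeal A • (I ^ (n + 1) • ⊤) := by
    rw [pow_succ_smul]
    exact Submodule.smul_mono_left hIm
  -- A crude reduction suffices here to identify `e₀`: all generator counts are at most `ℓ(M/yM)`,
  -- which serves as `n`.
  obtain ⟨x, hx, hxreg, n, hxn⟩ : ∃ x ∈ I, IsSMulRegular M x ∧ ∃ n,
      Ideal.span {x} • (I ^ n • ⊤ : Submodule A M) = I ^ (n + 1) • ⊤ := by
    obtain ⟨n, hn⟩ := ENat.ne_top_iff_exists.1 hyfin
    obtain ⟨x, hx, hreg, h⟩ := nakayama n (by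
      refine (relLength_anti _ Submodule.smul_le_right (hsmul n)).trans
        ((relLength_pow_smul_le hyI hyreg (hfin _)).trans ?_)
      rw [relLength_top, ← hn]
      exact le_self_add)
    exact ⟨x, hx, hreg, n, h⟩
  have hxfin : relLength ⊤ (Ideal.span {x} • ⊤ : Submodule A M) ≠ ⊤ := by
    refine ne_top_of_le_ne_top (hfin (n + 1)) (relLength_anti _ le_top ?_)
    rw [← hxn]
    exact Submodule.smul_mono le_rfl le_top
  rw [hilbertCoeff_zero_eq hdim hxreg hxfin hfin hxn]
  obtain ⟨e, he⟩ := ENat.ne_top_iff_exists.1 hxfin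
  rw [← he, ENat.toNat_natCast]
  have hne (i j k : ℕ) : maximalIdeal A ^ i • (maximalIdeal A ^ j • (I ^ k • (⊤ : Submodule A M))) ≠
      ⊥ := by
    intro h0
    obtain ⟨m, hm⟩ := exists_ne (0 : M)
    refine hm (isSMulRegular_iff_right_eq_zero_of_smul.1 (hyreg.pow (i + j + k)) m ?_)
    rw [← Submodule.mem_bot A, ← h0, pow_add, pow_add, mul_smul, mul_smul]
    exact Submodule.smul_mem_smul (Ideal.pow_mem_pow (hIm hyI) i)
      (Submodule.smul_mem_smul (Ideal.pow_mem_pow (hIm hyI) j) (pow_smul_mem_pow_smul_top hyI k m))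
  -- From `b ≤ ℓ(M/𝔪^b M) ≤ ℓ(M/IM) ≤ e`; hence the truncated difference `e - b` is the true one.
  have hbe : b ≤ e := by
    have h1 := le_relLength_maximalIdeal_pow_smul (⊤ : Submodule A M) b
      (fun i _ => by simpa using hne i 0 0)
    have h2 := relLength_pow_smul_le (n := 0) hx hxreg (hfin 0)
    rw [pow_zero, one_smul, zero_add, pow_one, ← he] at h2
    exact_mod_cast h1.trans ((relLength_anti _ le_top hb).trans h2)
  refine ⟨e - b, by push_cast [hbe]; ring, nakayama (e - b) ?_⟩
  -- From here on `b + 1` plays the role of `b`, so `𝔪J` contributes a chain of length `b`.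
  obtain ⟨b, rfl⟩ := Nat.exists_eq_add_of_le' hb0
  set J : Submodule A M := I ^ (e - (b + 1) + 1) • ⊤ with hJ
  have h1 := le_relLength_maximalIdeal_pow_smul (maximalIdeal A • J) b
    (fun i _ => by simpa using hne i 1 _)
  have h2 := relLength_add (Submodule.smul_le_right : maximalIdeal A • J ≤ J)
    (Submodule.smul_le_right : maximalIdeal A ^ b • maximalIdeal A • J ≤ _)
  have h3 : relLength J (maximalIdeal A ^ b • maximalIdeal A • J) ≤ e := by
    rw [he]
    refine le_trans (relLength_anti _ (Submodule.smul_le_right.trans Submodule.smul_le_right) ?_)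
      (relLength_pow_smul_le (n := e - (b + 1) + 1) hx hxreg (hfin _))
    have h4 : maximalIdeal A ^ b • maximalIdeal A • J =
        I ^ (e - (b + 1) + 1) • (maximalIdeal A ^ (b + 1) • ⊤) := by
      rw [hJ, ← Submodule.mul_smul, ← pow_succ, ← Submodule.mul_smul, mul_comm, Submodule.mul_smul]
    rw [h4, pow_succ I, Submodule.mul_smul]
    exact Submodule.smul_mono le_rfl hb
  rw [← h2] at h3
  have h4 := (add_le_add_left h1 (relLength J (maximalIdeal A • J))).trans h3
  have h5 : relLength J (maximalIdeal A • J) ≠ ⊤ :=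
    ne_top_of_le_ne_top (ENat.natCast_ne_top e) (le_add_self.trans h4)
  obtain ⟨d, hd⟩ := ENat.ne_top_iff_exists.1 h5
  rw [← hd] at h4 ⊢
  have h6 : b + d ≤ e := by exact_mod_cast h4
  have h7 : d ≤ e - (b + 1) + 1 := by omega
  exact_mod_cast h7

end Main

/-! ### Vanishing of Čech cohomology in degrees 0 and 1 -/

section Cech

variable {R : Type*} [CommRing R] {s : ℕ} (f : Fin s → R) {E : Type*} [AddCommGroup E] [Module R E]
  (ℰ : ℤ → AddSubgroup E)

/-- The fraction `e / (∏ j ∈ J, f j) ^ k`. -/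
noncomputable def cechFrac (J : Finset (Fin s)) (e : E) (k : ℕ) : CechLoc f E J :=
  LocalizedModule.mk e ⟨(∏ j ∈ J, f j) ^ k, pow_mem (Submonoid.mem_powers _) k⟩

lemma cechFrac_eq_iff {J : Finset (Fin s)} {e e' : E} {k k' : ℕ} :
    cechFrac f J e k = cechFrac f J e' k' ↔
      ∃ r : ℕ, (∏ j ∈ J, f j) ^ (r + k') • e = (∏ j ∈ J, f j) ^ (r + k) • e' := by
  rw [cechFrac, cechFrac, LocalizedModule.mk_eq]
  constructor
  · rintro ⟨⟨_, r, rfl⟩, h⟩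
    refine ⟨r, ?_⟩
    rw [pow_add, pow_add, mul_smul, mul_smul]
    exact h
  · rintro ⟨r, h⟩
    refine ⟨⟨_, r, rfl⟩, ?_⟩
    rw [pow_add, pow_add, mul_smul, mul_smul] at h
    exact h

lemma cechFrac_add {J : Finset (Fin s)} (e e' : E) (k k' : ℕ) :
    cechFrac f J e k + cechFrac f J e' k' =
      cechFrac f J ((∏ j ∈ J, f j) ^ k' • e + (∏ j ∈ J, f j) ^ k • e') (k + k') := by
  rw [cechFrac, cechFrac, LocalizedModule.mk_add_mk, cechFrac]
  congr 1
  exact Subtype.ext (pow_add _ _ _).symm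

lemma cechFrac_neg {J : Finset (Fin s)} (e : E) (k : ℕ) :
    -cechFrac f J e k = cechFrac f J (-e) k := by
  rw [cechFrac, ← LocalizedModule.mk_neg, cechFrac]

lemma cechFrac_zero {J : Finset (Fin s)} (k : ℕ) : cechFrac f J (0 : E) k = 0 :=
  LocalizedModule.zero_mk _

lemma cechFrac_pow_smul {J : Finset (Fin s)} (e : E) (k l : ℕ) :
    cechFrac f J ((∏ j ∈ J, f j) ^ l • e) (k + l) = cechFrac f J e k := by
  rw [cechFrac_eq_iff]
  refine ⟨0, ?_⟩
  rw [smul_smul, ← pow_add]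
  congr 2
  omega

lemma cechRes_cechFrac {K J : Finset (Fin s)} (h : K ⊆ J) (e : E) (k : ℕ) :
    cechRes f E h (cechFrac f K e k) = cechFrac f J ((∏ j ∈ J \ K, f j) ^ k • e) k := by
  rw [cechRes, cechFrac, LocalizedModule.lift_mk]
  refine (Module.End.algebraMap_isUnit_inv_apply_eq_iff _ _ _ _).2 ?_
  rw [cechFrac, LocalizedModule.smul'_mk, LocalizedModule.mkLinearMap_apply, LocalizedModule.mk_eq]
  refine ⟨1, ?_⟩
  simp only [one_smul, Submonoid.smul_def, smul_smul, ← mul_pow]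
  rw [mul_comm, Finset.prod_sdiff h]

lemma cechRes_congr {p : ℕ} (c : CechCochain f E p) {K K' J : Finset (Fin s)} (hK : K = K')
    (h : K ⊆ J) (hc : K.card = p) :
    cechRes f E h (c ⟨K, hc⟩) = cechRes f E (hK ▸ h) (c ⟨K', hK ▸ hc⟩) := by
  subst hK; rfl

lemma cechD_zero_apply (c : CechCochain f E 0) (j : Fin s) :
    cechD f E 0 c ⟨{j}, Finset.card_singleton j⟩ =
      cechRes f E (Finset.empty_subset {j}) (c ⟨∅, Finset.card_empty⟩) := by
  simp only [cechD, LinearMap.pi_apply, LinearMap.sum_apply, LinearMap.smul_apply,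
    LinearMap.comp_apply, LinearMap.proj_apply]
  rw [Fintype.sum_eq_single ⟨j, Finset.mem_singleton_self j⟩]
  · rw [Finset.filter_singleton, if_neg (lt_irrefl j), Finset.card_empty, pow_zero, one_smul]
    exact cechRes_congr f c (Finset.erase_singleton j) _ _
  · rintro ⟨a, ha⟩ hne
    exact absurd (Subtype.ext (Finset.mem_singleton.1 ha)) hne

lemma cechD_one_apply (c : CechCochain f E 1) {i j : Fin s} (hij : i < j) :
    cechD f E 1 c ⟨{i, j}, Finset.card_pair hij.ne⟩ =
      cechRes f E (by simp) (c ⟨{j}, Finset.card_singleton j⟩) -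
      cechRes f E (by simp) (c ⟨{i}, Finset.card_singleton i⟩) := by
  simp only [cechD, LinearMap.pi_apply, LinearMap.sum_apply, LinearMap.smul_apply,
    LinearMap.comp_apply, LinearMap.proj_apply]
  rw [Fintype.sum_eq_add ⟨i, by simp⟩ ⟨j, by simp⟩ (fun h => hij.ne (congrArg Subtype.val h))]
  · have h1 : (({i, j} : Finset (Fin s)).filter (· < i)) = ∅ := by
      ext a
      simp only [Finset.mem_filter, Finset.mem_insert, Finset.mem_singleton, Finset.notMem_empty,
        iff_false, not_and]
      rintro (rfl | rfl)
      · exact lt_irrefl _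
      · exact hij.not_gt
    have h2 : (({i, j} : Finset (Fin s)).filter (· < j)) = {i} := by
      ext a
      simp only [Finset.mem_filter, Finset.mem_insert, Finset.mem_singleton]
      constructor
      · rintro ⟨rfl | rfl, h⟩
        · rfl
        · exact absurd h (lt_irrefl _)
      · rintro rfl
        exact ⟨Or.inl rfl, hij⟩
    rw [h1, h2, Finset.card_empty, Finset.card_singleton, pow_zero, pow_one, one_smul, neg_one_smul,
      ← sub_eq_add_neg]
    congr 1
    · exact cechRes_congr f c (by ext a; simp; grind) _ _
    · exact cechRes_congr f c (by ext a; simp; grind) _ _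
  · rintro ⟨a, ha⟩ ⟨hi, hj⟩
    rw [Finset.mem_insert, Finset.mem_singleton] at ha
    rcases ha with rfl | rfl
    · exact absurd rfl hi
    · exact absurd rfl hj

lemma exists_pow_smul_eq_of_cechD_one_eq_zero {c : CechCochain f E 1} (hc : cechD f E 1 c = 0)
    {e : Fin s → E} {k : ℕ}
    (he : ∀ j, c ⟨{j}, Finset.card_singleton j⟩ = cechFrac f {j} (e j) k) (i j : Fin s) :
    ∃ r, (f i * f j) ^ r • f i ^ k • e j = (f i * f j) ^ r • f j ^ k • e i := by
  have key (i j : Fin s) (hij : i < j) :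
      ∃ r, (f i * f j) ^ r • f i ^ k • e j = (f i * f j) ^ r • f j ^ k • e i := by
    have h1 := congrFun hc ⟨{i, j}, Finset.card_pair hij.ne⟩
    rw [cechD_one_apply f c hij, Pi.zero_apply, sub_eq_zero, he, he, cechRes_cechFrac,
      cechRes_cechFrac, cechFrac_eq_iff] at h1
    obtain ⟨r, hr⟩ := h1
    have h2 : ({i, j} : Finset (Fin s)) \ {j} = {i} := by ext a; simp; grind
    have h3 : ({i, j} : Finset (Fin s)) \ {i} = {j} := by ext a; simp; grind
    rw [Finset.prod_pair hij.ne, h2, h3, Finset.prod_singleton, Finset.prod_singleton] at hr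
    exact ⟨_, hr⟩
  rcases lt_trichotomy i j with h | rfl | h
  · exact key i j h
  · exact ⟨0, rfl⟩
  · obtain ⟨r, hr⟩ := key j i h
    exact ⟨r, by rw [mul_comm (f i)]; exact hr.symm⟩

variable (hfE : ∀ j m e, e ∈ ℰ m → f j • e ∈ ℰ (m + 1))
include hfE

lemma prod_pow_smul_mem (J : Finset (Fin s)) (k : ℕ) {m : ℤ} {e : E} (he : e ∈ ℰ m) :
    (∏ j ∈ J, f j) ^ k • e ∈ ℰ (m + k * J.card) := by
  have h1 : ∀ m e, e ∈ ℰ m → (∏ j ∈ J, f j) • e ∈ ℰ (m + J.card) := by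
    induction J using Finset.induction_on with
    | empty => intro m e he; simpa using he
    | insert a J ha ih =>
      intro m e he
      rw [Finset.prod_insert ha, mul_smul, Finset.card_insert_of_notMem ha]
      have := hfE a _ _ (ih m e he)
      push_cast
      rwa [← add_assoc]
  induction k with
  | zero => simpa using he
  | succ k ih =>
    have := h1 _ _ ih
    rw [pow_succ', mul_smul]
    convert this using 2
    push_cast
    ring

lemma mem_cechLocDeg_iff {J : Finset (Fin s)} {n : ℤ} {y : CechLoc f E J} :
    y ∈ cechLocDeg f ℰ J n ↔ ∃ (k : ℕ) (e : E), e ∈ ℰ (n + k * J.card) ∧ y = cechFrac f J e k := by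
  refine ⟨fun hy => ?_, fun ⟨k, e, he, hy⟩ => AddSubgroup.subset_closure ⟨k, e, he, hy⟩⟩
  induction hy using AddSubgroup.closure_induction with
  | mem y hy => exact hy
  | zero => exact ⟨0, 0, zero_mem _, (cechFrac_zero f 0).symm⟩
  | add y y' _ _ hy hy' =>
    obtain ⟨k, e, he, rfl⟩ := hy
    obtain ⟨k', e', he', rfl⟩ := hy'
    refine ⟨k + k', _, add_mem ?_ ?_, cechFrac_add f e e' k k'⟩
    · convert prod_pow_smul_mem f ℰ hfE J k' he using 2
      push_cast; ring
    · convert prod_pow_smul_mem f ℰ hfE J k he' using 2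
      push_cast; ring
  | neg y _ hy =>
    obtain ⟨k, e, he, rfl⟩ := hy
    exact ⟨k, -e, neg_mem he, cechFrac_neg f e k⟩

/-- A homogeneous fraction may be written with any large exponent of the denominator. -/
lemma exists_forall_ge_cechFrac {J : Finset (Fin s)} {n : ℤ} {y : CechLoc f E J}
    (hy : y ∈ cechLocDeg f ℰ J n) : ∃ k₀ : ℕ, ∀ k ≥ k₀, ∃ e ∈ ℰ (n + k * J.card),
      y = cechFrac f J e k := by
  obtain ⟨k, e, he, rfl⟩ := (mem_cechLocDeg_iff f ℰ hfE).1 hy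
  refine ⟨k, fun l hl => ?_⟩
  obtain ⟨d, rfl⟩ := Nat.exists_eq_add_of_le hl
  refine ⟨_, ?_, (cechFrac_pow_smul f e k d).symm⟩
  convert prod_pow_smul_mem f ℰ hfE J d he using 2
  push_cast; ring

omit hfE

variable {ℰ} {x : R} {ρ : ℤ} (hxE : ∀ m e, e ∈ ℰ m → x • e ∈ ℰ (m + 1))
  (hinj : ∀ m ≥ ρ, ∀ e ∈ ℰ m, x • e = 0 → e = 0)
  (hsurj : ∀ m ≥ ρ, ∀ e ∈ ℰ (m + 1), ∃ e' ∈ ℰ m, x • e' = e)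

include hxE hinj in
lemma eq_zero_of_pow_smul_eq_zero {m : ℤ} (hm : ρ ≤ m) (N : ℕ) {e : E} (he : e ∈ ℰ m)
    (h : x ^ N • e = 0) : e = 0 := by
  induction N generalizing m e with
  | zero => simpa using h
  | succ N ih =>
    rw [pow_succ, mul_smul] at h
    exact hinj m hm e he (ih (by omega) (hxE m e he) h)

include hsurj in
lemma exists_pow_smul_eq {m : ℤ} (hm : ρ ≤ m) (N : ℕ) {e : E} (he : e ∈ ℰ (m + N)) :
    ∃ e' ∈ ℰ m, x ^ N • e' = e := by
  induction N generalizing e with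
  | zero => exact ⟨e, by simpa using he, by simp⟩
  | succ N ih =>
    push_cast at he
    rw [← add_assoc] at he
    obtain ⟨e₁, he₁, rfl⟩ := hsurj _ (by omega) e he
    obtain ⟨e₂, he₂, rfl⟩ := ih he₁
    exact ⟨e₂, he₂, by rw [pow_succ', mul_smul]⟩

lemma exists_pow_mem_span_pow (hxf : x ∈ Ideal.span (Set.range f)) (K : ℕ) :
    ∃ N, x ^ N ∈ Ideal.span (Set.range fun j => f j ^ K) := by
  have h : Ideal.span (Set.range f) ≤ (Ideal.span (Set.range fun j => f j ^ K)).radical := by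
    rw [Ideal.span_le]
    rintro _ ⟨j, rfl⟩
    exact ⟨K, Ideal.subset_span ⟨j, rfl⟩⟩
  exact h hxf

-- A 0-cocycle is an element killed by powers of all `f j`, hence by a power of `x`, which acts
-- injectively in degrees `≥ ρ`.
include hfE hxE hinj in
lemma cechHDeg_zero_eq_bot (hxf : x ∈ Ideal.span (Set.range f)) {n : ℤ} (hn : ρ ≤ n) :
    cechHDeg f ℰ 0 n = ⊥ := by
  rw [cechHDeg, AddSubgroup.closure_eq_bot_iff]
  rintro _ ⟨⟨c, hc⟩, hdeg, rfl⟩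
  replace hdeg : ∀ J, c J ∈ cechLocDeg f ℰ J.1 n := hdeg
  refine (Submodule.Quotient.mk_eq_zero _).2 ?_
  change c = 0
  rw [LinearMap.mem_ker] at hc
  obtain ⟨k, e, he, hce⟩ := (mem_cechLocDeg_iff f ℰ hfE).1 (hdeg ⟨∅, Finset.card_empty⟩)
  have he : e ∈ ℰ n := by simpa using he
  have hj (j : Fin s) : ∃ r, f j ^ r • e = 0 := by
    have h1 := congrFun hc ⟨{j}, Finset.card_singleton j⟩
    rw [cechD_zero_apply, hce, cechRes_cechFrac, Pi.zero_apply, ← cechFrac_zero f 0,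
      cechFrac_eq_iff] at h1
    obtain ⟨r, hr⟩ := h1
    rw [Finset.sdiff_empty, Finset.prod_singleton, smul_zero, smul_smul, ← pow_add] at hr
    exact ⟨_, hr⟩
  choose r hr using hj
  obtain ⟨N, hN⟩ := exists_pow_mem_span_pow f hxf (∑ j, r j)
  have hxe : x ^ N • e = 0 := by
    have hle : Ideal.span (Set.range fun j => f j ^ (∑ j, r j)) ≤
        LinearMap.ker (LinearMap.toSpanSingleton R E e) := by
      rw [Ideal.span_le]
      rintro _ ⟨j, rfl⟩
      change f j ^ (∑ j, r j) • e = 0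
      rw [← Finset.add_sum_erase _ _ (Finset.mem_univ j), add_comm, pow_add, mul_smul, hr, smul_zero]
    exact hle hN
  have he0 := eq_zero_of_pow_smul_eq_zero hxE hinj hn N he hxe
  funext ⟨J, hJ⟩
  obtain rfl := Finset.card_eq_zero.1 hJ
  rw [hce, he0, cechFrac_zero]
  rfl

-- A global element `v` with `c j = v / 1` is obtained by dividing by a power of `x`: gluing the
-- numerators with coefficients of `x^N` gives `x^N v`, and injectivity of `x` then removes the
-- factor.
include hfE hxE hinj hsurj in
lemma cechHDeg_one_eq_bot (hxf : x ∈ Ideal.span (Set.range f)) (π : ℤ → E →+ E)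
    (hπ : ∀ m e, π m e ∈ ℰ m) (hπℰ : ∀ m, ∀ e ∈ ℰ m, π m e = e)
    (hπf : ∀ j m e, π (m + 1) (f j • e) = f j • π m e) {n : ℤ} (hn : ρ ≤ n) :
    cechHDeg f ℰ 1 n = ⊥ := by
  rw [cechHDeg, AddSubgroup.closure_eq_bot_iff]
  rintro _ ⟨⟨c, hc⟩, hdeg, rfl⟩
  replace hdeg : ∀ J, c J ∈ cechLocDeg f ℰ J.1 n := hdeg
  refine (Submodule.Quotient.mk_eq_zero _).2 ?_
  change c ∈ LinearMap.range (cechD f E 0)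
  rw [LinearMap.mem_ker] at hc
  have h1 (j : Fin s) := exists_forall_ge_cechFrac f ℰ hfE (hdeg ⟨{j}, Finset.card_singleton j⟩)
  choose k₀ hk₀ using h1
  have hk (j : Fin s) : ∑ j, k₀ j ≥ k₀ j :=
    Finset.single_le_sum (f := k₀) (fun _ _ => Nat.zero_le _) (Finset.mem_univ j)
  choose e he hce using fun j => hk₀ j _ (hk j)
  set k := ∑ j, k₀ j
  choose r hr using exists_pow_smul_eq_of_cechD_one_eq_zero f hc hce
  -- One exponent absorbs all torsion, so that the cocycle relations hold exactly between the new
  -- numerators.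
  set q := ∑ i, ∑ j, r i j with hq
  have hrq (i j : Fin s) : r i j ≤ q :=
    (Finset.single_le_sum (f := r i) (fun _ _ => Nat.zero_le _) (Finset.mem_univ j)).trans
      (Finset.single_le_sum (f := fun i => ∑ j, r i j) (fun _ _ => Nat.zero_le _)
        (Finset.mem_univ i))
  -- new numerators, over the denominators `f j ^ (k + q)`
  set u : Fin s → E := fun j => f j ^ q • e j with hu
  have hcu (j : Fin s) : c ⟨{j}, Finset.card_singleton j⟩ = cechFrac f {j} (u j) (k + q) := by
    rw [hce, ← cechFrac_pow_smul f (e j) k q, Finset.prod_singleton]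
  have hudeg (j : Fin s) : u j ∈ ℰ (n + (k + q : ℕ)) := by
    have := prod_pow_smul_mem f ℰ hfE {j} q (he j)
    rw [Finset.prod_singleton, Finset.card_singleton] at this
    convert this using 2
    push_cast; ring
  have huu (i j : Fin s) : f i ^ (k + q) • u j = f j ^ (k + q) • u i := by
    obtain ⟨d, hd⟩ := Nat.exists_eq_add_of_le (hrq i j)
    have h2 := congrArg (fun z => (f i * f j) ^ d • z) (hr i j)
    simp only [smul_smul, hu] at h2 ⊢
    convert h2 using 2
    · rw [hd]; ring
    · rw [hd]; ring
  -- Write `x^N = ∑ g i * f i ^ (k + q)`; then `w = ∑ g i • u i` satisfies `f j ^ (k + q) • w = x^N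
  -- • u j`.
  obtain ⟨N, hN⟩ := exists_pow_mem_span_pow f hxf (k + q)
  obtain ⟨g, hg⟩ := (Submodule.mem_span_range_iff_exists_fun R).1 hN
  set w := ∑ i, g i • u i with hw
  have hfw (j : Fin s) : f j ^ (k + q) • w = x ^ N • u j := by
    rw [hw, Finset.smul_sum, ← hg, Finset.sum_smul]
    refine Finset.sum_congr rfl fun i _ => ?_
    rw [smul_comm, ← huu, smul_smul, smul_eq_mul]
  have hπpow (j : Fin s) (l : ℕ) (m : ℤ) (z : E) : π (m + l) (f j ^ l • z) = f j ^ l • π m z := by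
    induction l with
    | zero => simp
    | succ l ih =>
      rw [pow_succ', mul_smul, mul_smul, ← ih, ← hπf]
      push_cast
      rw [add_assoc]
  have hxpow (l : ℕ) {m : ℤ} {z : E} (hz : z ∈ ℰ m) : x ^ l • z ∈ ℰ (m + l) := by
    induction l with
    | zero => simpa using hz
    | succ l ih =>
      rw [pow_succ', mul_smul]
      push_cast
      rw [← add_assoc]
      exact hxE _ _ ih
  -- The `g i` need not be homogeneous, so `w` is first replaced by its component of degree `n + N`.
  obtain ⟨v, hv, hxv⟩ := exists_pow_smul_eq hsurj hn N (hπ (n + N) w)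
  have hfv (j : Fin s) : f j ^ (k + q) • v = u j := by
    have hmem : f j ^ (k + q) • v ∈ ℰ (n + (k + q : ℕ)) := by
      simpa using prod_pow_smul_mem f ℰ hfE {j} (k + q) hv
    rw [← sub_eq_zero]
    refine eq_zero_of_pow_smul_eq_zero hxE hinj (by omega) N (sub_mem hmem (hudeg j)) ?_
    rw [smul_sub, smul_comm, hxv, ← hπpow, hfw, hπℰ, sub_self]
    convert hxpow N (hudeg j) using 2
    ring
  refine ⟨fun J => cechFrac f J.1 v 0, ?_⟩
  funext ⟨J, hJ⟩
  obtain ⟨j, rfl⟩ := Finset.card_eq_one.1 hJ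
  rw [cechD_zero_apply, cechRes_cechFrac, hcu, pow_zero, one_smul, ← hfv]
  rw [← cechFrac_pow_smul f v 0 (k + q), Finset.prod_singleton]
  simp only [zero_add]

end Cech

/-! ### Multiplication by an initial form on `G_I(M)` -/

section GradedModule

variable {A : Type*} [CommRing A] {I : Ideal A} {M : Type*} [AddCommGroup M] [Module A M]

lemma of_smul_of_gr {m n : ℕ} (a : GrPiece I A m) (z : GrPiece I M n) :
    (DirectSum.of (GrPiece I A) m a : GrRing I) • (DirectSum.of (GrPiece I M) n z : GrModule I M) =
      DirectSum.of (GrPiece I M) (m + n) (grSMul I M m n a z) :=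
  DirectSum.Gmodule.of_smul_of _ _ a z

lemma grMk_eq_zero_iff {n : ℕ} {x : M} {hx : x ∈ (I ^ n • ⊤ : Submodule A M)} :
    grMk I n x hx = 0 ↔ x ∈ (I ^ (n + 1) • ⊤ : Submodule A M) :=
  Submodule.Quotient.mk_eq_zero _

lemma smul_grMk {n : ℕ} (a : A) {x : M} (hx : x ∈ (I ^ n • ⊤ : Submodule A M)) :
    a • grMk I n x hx = grMk I n (a • x) (Submodule.smul_mem _ a hx) := rfl

lemma of_grMk_congr {m n : ℕ} (h : m = n) {x : M} (hx : x ∈ (I ^ m • ⊤ : Submodule A M)) :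
    DirectSum.of (GrPiece I M) m (grMk I m x hx) =
      DirectSum.of (GrPiece I M) n (grMk I n x (h ▸ hx)) := by
  subst h; rfl

variable (I M) in
/-- The projection of the associated graded module onto its component of degree `m`. -/
noncomputable def grProj (m : ℤ) : GrModule I M →+ GrModule I M :=
  DFinsupp.filterAddMonoidHom (GrPiece I M) fun k : ℕ => (k : ℤ) = m

lemma grProj_apply (m : ℤ) (e : GrModule I M) (k : ℕ) :
    grProj I M m e k = if (k : ℤ) = m then e k else 0 := by
  classical
  exact DFinsupp.filter_apply _ _ _

lemma grProj_mem (m : ℤ) (e : GrModule I M) : grProj I M m e ∈ grComponent I M m := fun k hk => by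
  rw [grProj_apply, if_neg hk]

lemma grProj_of_mem {m : ℤ} {e : GrModule I M} (he : e ∈ grComponent I M m) :
    grProj I M m e = e := by
  ext k
  rw [grProj_apply]
  split_ifs with h
  · rfl
  · exact (he k h).symm

lemma grProj_of (m : ℤ) (k : ℕ) (z : GrPiece I M k) :
    grProj I M m (DirectSum.of (GrPiece I M) k z) =
      if (k : ℤ) = m then DirectSum.of (GrPiece I M) k z else 0 := by
  classical
  exact DFinsupp.filter_single _ _ _

lemma grProj_of_one_smul (y : GrPiece I A 1) (m : ℤ) (e : GrModule I M) :
    grProj I M (m + 1) ((DirectSum.of (GrPiece I A) 1 y : GrRing I) • e) =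
      (DirectSum.of (GrPiece I A) 1 y : GrRing I) • grProj I M m e := by
  induction e using DirectSum.induction_on with
  | zero => simp only [map_zero, smul_zero]
  | of k z =>
    rw [of_smul_of_gr, grProj_of, grProj_of]
    by_cases h : (k : ℤ) = m
    · rw [if_pos h, if_pos (by push_cast; omega), of_smul_of_gr]
    · rw [if_neg h, if_neg (by push_cast; omega), smul_zero]
  | add a b ha hb => rw [smul_add, map_add, map_add, smul_add, ha, hb]

lemma of_one_smul_mem (y : GrPiece I A 1) (m : ℤ) (e : GrModule I M) (he : e ∈ grComponent I M m) :
    (DirectSum.of (GrPiece I A) 1 y : GrRing I) • e ∈ grComponent I M (m + 1) := by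
  rw [← grProj_of_mem he, ← grProj_of_one_smul]
  exact grProj_mem _ _

lemma exists_eq_of_of_mem_grComponent {k : ℕ} {e : GrModule I M} (he : e ∈ grComponent I M k) :
    ∃ z, e = DirectSum.of (GrPiece I M) k z := by
  refine ⟨e k, ?_⟩
  ext l
  by_cases h : l = k
  · subst h
    rw [DirectSum.of_eq_same]
  · rw [he l (by exact_mod_cast h), DirectSum.of_eq_of_ne _ _ _ h]

variable {x : A} (hx : x ∈ (I ^ 1 • ⊤ : Submodule A A)) {n : ℕ}

/-- If `xw ∈ I^(k+2) M = x I^(k+1) M`, cancelling the regular `x` gives `w ∈ I^(k+1) M`. -/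
lemma of_one_smul_eq_zero (hreg : IsSMulRegular M x)
    (h : ∀ k ≥ n, Ideal.span {x} • (I ^ k • ⊤ : Submodule A M) = I ^ (k + 1) • ⊤) {m : ℤ}
    (hm : (n : ℤ) ≤ m) {e : GrModule I M} (he : e ∈ grComponent I M m)
    (h0 : (DirectSum.of (GrPiece I A) 1 (grMk I 1 x hx) : GrRing I) • e = 0) : e = 0 := by
  obtain ⟨k, rfl⟩ := Int.eq_ofNat_of_zero_le ((Int.natCast_nonneg n).trans hm)
  obtain ⟨z, rfl⟩ := exists_eq_of_of_mem_grComponent he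
  obtain ⟨w, hw, rfl⟩ := grMk_surj I z
  rw [of_smul_of_gr, grSMul_mk] at h0
  have h1 := congrArg (fun e : GrModule I M => e (1 + k)) h0
  simp only [DirectSum.of_eq_same] at h1
  have h2 := grMk_eq_zero_iff.1 h1
  rw [show 1 + k + 1 = k + 1 + 1 by ring, ← h (k + 1) (by omega), mem_span_singleton_smul] at h2
  obtain ⟨p, hp, hpw⟩ := h2
  obtain rfl := hreg hpw
  rw [grMk_eq_zero_iff.2 hp, map_zero]

lemma exists_of_one_smul_eq
    (h : ∀ k ≥ n, Ideal.span {x} • (I ^ k • ⊤ : Submodule A M) = I ^ (k + 1) • ⊤) {m : ℤ}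
    (hm : (n : ℤ) ≤ m) {e : GrModule I M} (he : e ∈ grComponent I M (m + 1)) :
    ∃ e' ∈ grComponent I M m,
      (DirectSum.of (GrPiece I A) 1 (grMk I 1 x hx) : GrRing I) • e' = e := by
  obtain ⟨k, rfl⟩ := Int.eq_ofNat_of_zero_le ((Int.natCast_nonneg n).trans hm)
  obtain ⟨z, rfl⟩ := exists_eq_of_of_mem_grComponent (k := k + 1) (by exact_mod_cast he)
  obtain ⟨w, hw, rfl⟩ := grMk_surj I z
  have hw' := hw
  rw [← h k (by exact_mod_cast hm), mem_span_singleton_smul] at hw'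
  obtain ⟨p, hp, rfl⟩ := hw'
  refine ⟨DirectSum.of (GrPiece I M) k (grMk I k p hp), ?_, ?_⟩
  · have := grProj_mem (k : ℤ) (DirectSum.of (GrPiece I M) k (grMk I k p hp))
    rwa [grProj_of, if_pos rfl] at this
  · rw [of_smul_of_gr, grSMul_mk]
    exact of_grMk_congr (add_comm 1 k) _

end GradedModule

/-! ### The dimension of `G_I(M)` is at most one -/

section Dimension

lemma ringKrullDim_le_of_isIntegral (C B : Type*) [CommRing C] [CommRing B] [Algebra C B]
    [Algebra.IsIntegral C B] : ringKrullDim B ≤ ringKrullDim C :=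
  Order.krullDim_le_of_strictMono (PrimeSpectrum.comap (algebraMap C B)) fun _ _ h =>
    Ideal.IsIntegral.comap_lt_comap h

/-- Elements of `R` act as `C`-endomorphisms of a finite module, so `R / Ann E` is integral over
`C`. -/
lemma supportDim_le_ringKrullDim_of_finite (C R E : Type*) [CommRing C] [CommRing R] [Algebra C R]
    [AddCommGroup E] [Module C E] [Module R E] [IsScalarTower C R E] [Module.Finite C E] :
    Module.supportDim R E ≤ ringKrullDim C := by
  have : Module.Finite R E := Module.Finite.of_restrictScalars_finite C R E
  rw [Module.supportDim_eq_ringKrullDim_quotient_annihilator]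
  have : Algebra.IsIntegral C (R ⧸ Module.annihilator R E) := by
    refine ⟨fun b => ?_⟩
    obtain ⟨r, rfl⟩ := Ideal.Quotient.mk_surjective b
    obtain ⟨p, hp, hpr⟩ := Algebra.IsIntegral.isIntegral (R := C) (Algebra.lsmul C C E r)
    refine ⟨p, hp, ?_⟩
    rw [← Polynomial.aeval_def] at hpr ⊢
    rw [Polynomial.aeval_algHom_apply] at hpr
    have : Ideal.Quotient.mk (Module.annihilator R E) r =
      Ideal.Quotient.mkₐ C (Module.annihilator R E) r := rfl
    rw [this, Polynomial.aeval_algHom_apply]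
    refine Ideal.Quotient.eq_zero_iff_mem.2 (Module.mem_annihilator.2 fun e => ?_)
    exact LinearMap.congr_fun hpr e
  exact ringKrullDim_le_of_isIntegral C _

variable {A : Type*} [CommRing A] (I : Ideal A)

/-- The ring homomorphism from `A` onto the component of degree zero of `⨁ n, I ^ n / I ^ (n + 1)`. -/
noncomputable def grZeroHom : A →+* GrRing I where
  toFun a := DirectSum.of (GrPiece I A) 0 (grMk I 0 a (by simp))
  map_one' := rfl
  map_mul' a b := by
    rw [DirectSum.of_mul_of]
    exact DirectSum.of_eq_of_gradedMonoid_eq (grMk_sigma I (zero_add 0).symm rfl _ _)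
  map_zero' := by rw [grMk_eq_zero_iff.2 (zero_mem _), map_zero]
  map_add' a b := by
    rw [← map_add]
    rfl

variable {I}

lemma grZeroHom_eq_zero {a : A} (ha : a ∈ I) : grZeroHom I a = 0 := by
  change DirectSum.of (GrPiece I A) 0 (grMk I 0 a _) = 0
  rw [grMk_eq_zero_iff.2 (by simpa using ha), map_zero]

variable {M : Type*} [AddCommGroup M] [Module A M]

lemma grZeroHom_smul_of (a : A) {k : ℕ} (z : GrPiece I M k) :
    grZeroHom I a • (DirectSum.of (GrPiece I M) k z : GrModule I M) =
      DirectSum.of (GrPiece I M) k (a • z) := by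
  obtain ⟨w, hw, rfl⟩ := grMk_surj I z
  change (DirectSum.of (GrPiece I A) 0 (grMk I 0 a _) : GrRing I) • _ = _
  rw [of_smul_of_gr, grSMul_mk, smul_grMk]
  exact of_grMk_congr (zero_add k) _

/-- Components of degree `≤ n` generate `G_I(M)` over `(A/I)[X]`, since `X` maps each degree `≥ n`
onto the next. As `A/I` is Artinian, this polynomial ring has dimension at most 1. -/
lemma supportDim_grModule_le_one [IsNoetherianRing A] [IsLocalRing A] [Module.Finite A M]
    (hI : I.radical = IsLocalRing.maximalIdeal A) {x : A} (hx : x ∈ (I ^ 1 • ⊤ : Submodule A A))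
    {n : ℕ} (h : ∀ k ≥ n, Ideal.span {x} • (I ^ k • ⊤ : Submodule A M) = I ^ (k + 1) • ⊤) :
    Module.supportDim (GrRing I) (GrModule I M) ≤ 1 := by
  let φ : A ⧸ I →+* GrRing I := Ideal.Quotient.lift I (grZeroHom I) fun a => grZeroHom_eq_zero
  let ψ : Polynomial (A ⧸ I) →+* GrRing I :=
    Polynomial.eval₂RingHom φ (DirectSum.of (GrPiece I A) 1 (grMk I 1 x hx))
  let _ : Algebra (Polynomial (A ⧸ I)) (GrRing I) := ψ.toAlgebra
  let _ : Module (Polynomial (A ⧸ I)) (GrModule I M) := Module.compHom _ ψ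
  have hsmul (c : Polynomial (A ⧸ I)) (e : GrModule I M) : c • e = ψ c • e := rfl
  have : IsScalarTower (Polynomial (A ⧸ I)) (GrRing I) (GrModule I M) :=
    ⟨fun c r e => by rw [hsmul, ← mul_smul]; rfl⟩
  have hψC (a : A) : ψ (Polynomial.C (Ideal.Quotient.mk I a)) = grZeroHom I a := by
    simp [ψ, φ]
  have hψX : ψ Polynomial.X = DirectSum.of (GrPiece I A) 1 (grMk I 1 x hx) := by
    simp [ψ]
  have hfg (k : ℕ) : ∃ t : Finset (GrPiece I M k), Submodule.span A (t : Set (GrPiece I M k)) = ⊤ := by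
    have : Module.Finite A (GrPiece I M k) :=
      inferInstanceAs (Module.Finite A ((I ^ k • ⊤ : Submodule A M) ⧸
        (I ^ (k + 1) • ⊤ : Submodule A M).submoduleOf (I ^ k • ⊤ : Submodule A M)))
    exact Module.Finite.fg_top
  choose t ht using hfg
  have : Module.Finite (Polynomial (A ⧸ I)) (GrModule I M) := by
    let S : Set (GrModule I M) := ⋃ k ∈ Finset.range (n + 1),
      DirectSum.of (GrPiece I M) k '' (t k : Set (GrPiece I M k))
    have hS : S.Finite := Set.Finite.biUnion (Finset.finite_toSet _)
      fun k _ => (Finset.finite_toSet _).image _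
    refine ⟨Submodule.fg_def.2 ⟨S, hS, ?_⟩⟩
    set N := Submodule.span (Polynomial (A ⧸ I)) S with hN
    have hlow (k : ℕ) (hk : k ≤ n) (z : GrPiece I M k) : DirectSum.of (GrPiece I M) k z ∈ N := by
      have hz : z ∈ Submodule.span A (t k : Set (GrPiece I M k)) := ht k ▸ trivial
      induction hz using Submodule.span_induction with
      | mem z hz =>
        exact Submodule.subset_span (Set.mem_biUnion (Finset.mem_coe.2
          (Finset.mem_range.2 (Nat.lt_succ_of_le hk))) ⟨z, hz, rfl⟩)
      | zero => rw [map_zero]; exact zero_mem _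
      | add z z' _ _ hz hz' => rw [map_add]; exact add_mem hz hz'
      | smul a z _ hz =>
        rw [← grZeroHom_smul_of, ← hψC, ← hsmul]
        exact Submodule.smul_mem _ _ hz
    have hall (k : ℕ) (z : GrPiece I M (n + k)) : DirectSum.of (GrPiece I M) (n + k) z ∈ N := by
      induction k with
      | zero => exact hlow _ le_rfl z
      | succ k ih =>
        have hmem := grProj_mem ((n + k : ℕ) + 1 : ℤ) (DirectSum.of (GrPiece I M) (n + (k + 1)) z)
        rw [grProj_of, if_pos (by push_cast; ring)] at hmem
        obtain ⟨e', he', heq⟩ := exists_of_one_smul_eq hx h (m := (n + k : ℕ)) (by push_cast; omega) hmem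
        obtain ⟨z', rfl⟩ := exists_eq_of_of_mem_grComponent he'
        rw [← heq, ← hψX, ← hsmul]
        exact Submodule.smul_mem _ _ (ih z')
    rw [eq_top_iff]
    intro e _
    induction e using DirectSum.induction_on with
    | zero => exact zero_mem _
    | of k z =>
      rcases le_total k n with hk | hk
      · exact hlow k hk z
      · obtain ⟨d, rfl⟩ := Nat.exists_eq_add_of_le hk
        exact hall d z
    | add a b ha hb => exact add_mem (ha trivial) (hb trivial)
  have hart := isArtinianRing_quotient_of_radical_eq hI
  have hdim : ringKrullDim (A ⧸ I) ≤ 0 := by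
    have := (isArtinianRing_iff_isNoetherianRing_krullDimLE_zero.1 hart).2
    rw [Ring.KrullDimLE, Order.krullDimLE_iff] at this
    exact_mod_cast this
  refine (supportDim_le_ringKrullDim_of_finite (Polynomial (A ⧸ I)) _ _).trans ?_
  rw [Polynomial.ringKrullDim_of_isNoetherianRing]
  calc ringKrullDim (A ⧸ I) + 1 ≤ 0 + 1 := by gcongr
    _ = 1 := zero_add 1

end Dimension

/-! ### From vanishing to the regularity bound -/

section Regularity

variable {R : Type*} [CommRing R] {s : ℕ} (f : Fin s → R) {E : Type*} [AddCommGroup E] [Module R E]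
  (ℰ : ℤ → AddSubgroup E)

lemma aInvariant_le {p : ℕ} {ρ : ℤ} (h : ∀ n ≥ ρ, cechHDeg f ℰ p n = ⊥) :
    aInvariant f ℰ p ≤ (((ρ - 1 : ℤ) : ℝ) : EReal) := by
  refine iSup₂_le fun n hn => ?_
  have hlt : n < ρ := not_le.1 fun hle => hn (h n hle)
  exact_mod_cast Int.le_sub_one_of_lt hlt

lemma cmRegularity_le_of_supportDim_le_one (hdim : Module.supportDim R E ≤ 1) {ρ : ℤ}
    (h0 : ∀ n ≥ ρ, cechHDeg f ℰ 0 n = ⊥) (h1 : ∀ n ≥ ρ, cechHDeg f ℰ 1 n = ⊥) :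
    cmRegularity f ℰ ≤ ((ρ : ℝ) : EReal) := by
  refine iSup₂_le fun p hp => ?_
  have hp1 : p ≤ 1 := by exact_mod_cast hp.trans hdim
  have key : aInvariant f ℰ p ≤ (((ρ - 1 : ℤ) : ℝ) : EReal) := by
    interval_cases p
    · exact aInvariant_le f ℰ h0
    · exact aInvariant_le f ℰ h1
  refine (add_le_add_left key _).trans ?_
  rw [← EReal.coe_add, EReal.coe_le_coe_iff]
  have : (p : ℝ) ≤ 1 := by exact_mod_cast hp1
  push_cast
  linarith

end Regularity

theorem mainTheorem2 {A : Type*} [CommRing A] [IsNoetherianRing A] [IsLocalRing A]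
    [Infinite (IsLocalRing.ResidueField A)]
    (I : Ideal A) (hI : I.radical = IsLocalRing.maximalIdeal A)
    (M : Type*) [AddCommGroup M] [Module A M]
    (hM : IsCMModule A M) (hdim : Module.supportDim A M = 1)
    (b : ℕ)
    (hb : IsGreatest
      {t : ℕ | I • (⊤ : Submodule A M) ≤ IsLocalRing.maximalIdeal A ^ t • (⊤ : Submodule A M)} b)
    {s : ℕ} (f : Fin s → GrPiece I A 1)
    (hf : Ideal.span (Set.range fun j => DirectSum.of (GrPiece I A) 1 (f j)) = grIrrelevant I) :
    cmRegularity (fun j => DirectSum.of (GrPiece I A) 1 (f j)) (grComponent I M) ≤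
        (((hilbertCoeff I M 0 - b : ℤ) : ℝ) : EReal) ∧
      (1 < b →
        cmRegularity (fun j => DirectSum.of (GrPiece I A) 1 (f j)) (grComponent I M) <
          (((hilbertCoeff I M 0 - 1 : ℤ) : ℝ) : EReal)) := by
  have hMfin := hM.1
  -- `IM ⊆ 𝔪M`, so maximality of `b` gives `b ≥ 1`.
  have hb0 : 1 ≤ b := hb.2 (by
    simpa using Submodule.smul_mono_left (N := (⊤ : Submodule A M)) (hI ▸ Ideal.le_radical))
  obtain ⟨n, hn, x, hxI, hreg, hxn⟩ := exists_span_singleton_smul_pow_eq hI hM hdim hb0 hb.1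
  have hx : x ∈ (I ^ 1 • ⊤ : Submodule A A) := by simpa using hxI
  have h : ∀ k ≥ n, Ideal.span {x} • (I ^ k • ⊤ : Submodule A M) = I ^ (k + 1) • ⊤ := by
    intro k hk
    obtain ⟨d, rfl⟩ := Nat.exists_eq_add_of_le hk
    exact pow_succ_smul_eq_of_le hxn d
  have hxf : (DirectSum.of (GrPiece I A) 1 (grMk I 1 x hx) : GrRing I) ∈
      Ideal.span (Set.range fun j => DirectSum.of (GrPiece I A) 1 (f j)) := by
    rw [hf]
    exact Ideal.subset_span ⟨1, Nat.one_pos, _, rfl⟩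
  have hle : cmRegularity (fun j => DirectSum.of (GrPiece I A) 1 (f j)) (grComponent I M) ≤
      (((hilbertCoeff I M 0 - b : ℤ) : ℝ) : EReal) := by
    rw [← hn]
    have hfE (j : Fin s) := of_one_smul_mem (M := M) (f j)
    have hxE := of_one_smul_mem (M := M) (grMk I 1 x hx)
    have hinj : ∀ m ≥ (n : ℤ), ∀ e ∈ grComponent I M m,
        (DirectSum.of (GrPiece I A) 1 (grMk I 1 x hx) : GrRing I) • e = 0 → e = 0 :=
      fun m hm e he => of_one_smul_eq_zero hx hreg h hm he
    have hsurj : ∀ m ≥ (n : ℤ), ∀ e ∈ grComponent I M (m + 1), ∃ e' ∈ grComponent I M m,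
        (DirectSum.of (GrPiece I A) 1 (grMk I 1 x hx) : GrRing I) • e' = e :=
      fun m hm e he => exists_of_one_smul_eq hx h hm he
    refine cmRegularity_le_of_supportDim_le_one _ _ (supportDim_grModule_le_one hI hx h)
      (fun m hm => cechHDeg_zero_eq_bot _ hfE hxE hinj hxf hm)
      (fun m hm => cechHDeg_one_eq_bot _ hfE hxE hinj hsurj hxf (grProj I M) grProj_mem
        (fun m e he => grProj_of_mem he) (fun j => grProj_of_one_smul (f j)) hm)
  refine ⟨hle, fun hb1 => hle.trans_lt ?_⟩
  rw [EReal.coe_lt_coe_iff]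
  exact_mod_cast (by omega : hilbertCoeff I M 0 - b < hilbertCoeff I M 0 - 1)
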